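/- **Theorem 5.1.** A complex quasi-projective variety is a Zariski locally closed subset of a complex projective space (not necessarily irreducible), and varieties are identified up to biregular isomorphism. Let $K_0(\mathcal V_{\mathbb C})$ be the Grothendieck ring of complex quasi-projective varieties: it is generated by the isomorphism classes $[X]$ of such varieties, modulo the relations $[X]=[Y]+[X\setminus Y]$ whenever $Y\subseteq X$ is a Zariski locally closed subset for which $X\setminus Y$ is again locally closed, with the multiplication $[X]\cdot[Y]=[X\times Y]$ and with $1=[\mathrm{pt}]$. For $n\ge 0$ let $\mathbb T^n_{\mathbb C}=(\mathbb C^*)^n$ be the algebraic torus, and let $X_\Pi^n$ be the permutohedral variety of dimension $n$, that is, the projective toric variety of the $n$-dimensional permutohedron $\pi_{n+1}\subset\mathbb R^{n+1}$, the convex hull of all permutations of $(1,2,\dots,n+1)$. Explicitly, $X_\Pi^n$ is the Zariski closure of the set of points $[t^a]_{a\in A}$, $t\in(\mathbb C^*)^{n+1}$, in the projective space with coordinates indexed by $A=\pi_{n+1}\cap\mathbb Z^{n+1}$, where $t^a=\prod_i t_i^{a_i}$. Then the exponential generating series $$\pi(x)=1+\sum_{n=1}^\infty [X_\Pi^{n-1}]\frac{x^n}{n!},\qquad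 \tau(x)=1-\sum_{n=1}^\infty[\mathbb T_{\mathbb C}^{n-1}]\frac{x^n}{n!}$$ are multiplicatively inverse to each other. Explicitly, put $p_0=1$, $p_n=[X_\Pi^{n-1}]$ and $q_0=1$, $q_n=-[\mathbb T_{\mathbb C}^{n-1}]$ for $n\ge 1$. Then $\sum_{k=0}^n\binom nk p_k\,q_{n-k}$ equals $1$ for $n=0$ and $0$ for $n\ge1$, as an identity in $K_0(\mathcal V_{\mathbb C})$; and $\pi(x)\,\tau(x)=1$ in the power series ring $(\mathbb Q\otimes_{\mathbb Z} K_0(\mathcal V_{\mathbb C}))[[x]]$. -/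

import Mathlib

open scoped TensorProduct LinearAlgebra.Projectivization

noncomputable section

namespace Motivic

/-! ### Complex projective spaces with the Zariski topology -/

/-- The complex projective space with homogeneous coordinates indexed by `ι`
(so `PSpace (Fin (N + 1))` is `ℙ^N(ℂ)`). -/
def PSpace (ι : Type) : Type := ℙ ℂ (ι → ℂ)

namespace PSpace

variable {ι κ : Type}

/-- The point `[v]` with homogeneous coordinates `v ≠ 0`. -/
def mk (v : ι → ℂ) (hv : v ≠ 0) : PSpace ι := Projectivization.mk ℂ v hv

/-- A vector of homogeneous coordinates of a point. -/
def rep (p : PSpace ι) : ι → ℂ := Projectivization.rep p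

lemma rep_ne_zero (p : PSpace ι) : p.rep ≠ 0 := Projectivization.rep_nonzero p

lemma mk_rep (p : PSpace ι) : mk p.rep p.rep_ne_zero = p := Projectivization.mk_rep p

lemma mk_eq_mk_iff {v w : ι → ℂ} (hv : v ≠ 0) (hw : w ≠ 0) :
    mk v hv = mk w hw ↔ ∃ a : ℂ, a • w = v := Projectivization.mk_eq_mk_iff' ℂ v w hv hw

lemma exists_rep_mk (v : ι → ℂ) (hv : v ≠ 0) : ∃ a : ℂ, a ≠ 0 ∧ (mk v hv).rep = a • v := by
  obtain ⟨a, ha⟩ := Projectivization.exists_smul_eq_mk_rep ℂ v hv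
  exact ⟨a, a.ne_zero, ha.symm⟩

/-- The open set `f ≠ 0` in projective space; it is used for homogeneous `f` only. -/
def basicOpen (f : MvPolynomial ι ℂ) : Set (PSpace ι) :=
  {p | MvPolynomial.eval p.rep f ≠ 0}

/-- The Zariski topology: the complements of hypersurfaces form a basis. -/
instance zariski : TopologicalSpace (PSpace ι) :=
  TopologicalSpace.generateFrom
    {U | ∃ (d : ℕ) (f : MvPolynomial ι ℂ), f.IsHomogeneous d ∧ U = basicOpen f}

lemma eval_smul {d : ℕ} {f : MvPolynomial ι ℂ} (hf : f.IsHomogeneous d) (a : ℂ) (v : ι → ℂ) :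
    MvPolynomial.eval (a • v) f = a ^ d * MvPolynomial.eval v f := by
  rw [MvPolynomial.eval_eq, MvPolynomial.eval_eq, Finset.mul_sum]
  refine Finset.sum_congr rfl fun m hm => ?_
  have h : ∑ i ∈ m.support, m i = d := by
    have := hf (MvPolynomial.mem_support_iff.1 hm)
    simpa [Finsupp.weight_apply, Finsupp.sum] using this
  simp only [Pi.smul_apply, smul_eq_mul, mul_pow, Finset.prod_mul_distrib, Finset.prod_pow_eq_pow_sum, h]
  ring

lemma mk_mem_basicOpen {d : ℕ} {f : MvPolynomial ι ℂ} (hf : f.IsHomogeneous d)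
    (v : ι → ℂ) (hv : v ≠ 0) : mk v hv ∈ basicOpen f ↔ MvPolynomial.eval v f ≠ 0 := by
  obtain ⟨a, ha, h⟩ := exists_rep_mk v hv
  simp [basicOpen, h, eval_smul hf, ha]

lemma isOpen_basicOpen {d : ℕ} {f : MvPolynomial ι ℂ} (hf : f.IsHomogeneous d) :
    IsOpen (basicOpen f) :=
  TopologicalSpace.isOpen_generateFrom_of_mem ⟨d, f, hf, rfl⟩

lemma isTopologicalBasis : TopologicalSpace.IsTopologicalBasis
    {U : Set (PSpace ι) | ∃ (d : ℕ) (f : MvPolynomial ι ℂ), f.IsHomogeneous d ∧ U = basicOpen f} := by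
  have h := TopologicalSpace.isTopologicalBasis_of_subbasis_of_inter
    (r := {U : Set (PSpace ι) | ∃ (d : ℕ) (f : MvPolynomial ι ℂ), f.IsHomogeneous d ∧ U = basicOpen f})
    rfl ?_
  · rwa [Set.insert_eq_of_mem] at h
    exact ⟨0, 1, MvPolynomial.isHomogeneous_one _ _, by ext; simp [basicOpen]⟩
  · rintro _ ⟨d, f, hf, rfl⟩ _ ⟨e, g, hg, rfl⟩
    exact ⟨d + e, f * g, hf.mul hg, by ext; simp [basicOpen]⟩

/-- A point outside a Zariski closed set is separated from it by a homogeneous polynomial. -/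
lemma exists_of_notMem {Z : Set (PSpace ι)} (hZ : IsClosed Z) {p : PSpace ι} (hp : p ∉ Z) :
    ∃ (d : ℕ) (f : MvPolynomial ι ℂ), f.IsHomogeneous d ∧ MvPolynomial.eval p.rep f ≠ 0 ∧
      ∀ q ∈ Z, MvPolynomial.eval q.rep f = 0 := by
  obtain ⟨_, ⟨d, f, hf, rfl⟩, hpU, hU⟩ :=
    isTopologicalBasis.exists_subset_of_mem_open (show p ∈ Zᶜ from hp) hZ.isOpen_compl
  exact ⟨d, f, hf, hpU, fun q hq => by_contra fun h => hU h hq⟩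

/-! ### The Segre embedding -/

lemma segre_ne_zero {x : ι → ℂ} {y : κ → ℂ} (hx : x ≠ 0) (hy : y ≠ 0) :
    (fun ij : ι × κ => x ij.1 * y ij.2) ≠ 0 := by
  obtain ⟨i, hi⟩ := Function.ne_iff.1 hx
  obtain ⟨j, hj⟩ := Function.ne_iff.1 hy
  exact Function.ne_iff.2 ⟨(i, j), mul_ne_zero hi hj⟩

/-- The Segre embedding `([x], [y]) ↦ [x_i y_j]`. -/
def segre (p : PSpace ι × PSpace κ) : PSpace (ι × κ) :=
  mk (fun ij => p.1.rep ij.1 * p.2.rep ij.2) (segre_ne_zero p.1.rep_ne_zero p.2.rep_ne_zero)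

lemma segre_injective : Function.Injective (segre : PSpace ι × PSpace κ → PSpace (ι × κ)) := by
  rintro ⟨x, y⟩ ⟨x', y'⟩ h
  obtain ⟨a, ha⟩ := (mk_eq_mk_iff _ _).1 h
  have key : ∀ i j, a * (x'.rep i * y'.rep j) = x.rep i * y.rep j := fun i j => congrFun ha (i, j)
  obtain ⟨i, hi⟩ := Function.ne_iff.1 x.rep_ne_zero
  obtain ⟨j, hj⟩ := Function.ne_iff.1 y.rep_ne_zero
  simp only [Pi.zero_apply] at hi hj
  refine Prod.ext ?_ ?_
  · change x = x'
    rw [← mk_rep x, ← mk_rep x', mk_eq_mk_iff]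
    refine ⟨a * y'.rep j / y.rep j, funext fun k => ?_⟩
    have := key k j
    simp only [Pi.smul_apply, smul_eq_mul]
    field_simp
    linear_combination this
  · change y = y'
    rw [← mk_rep y, ← mk_rep y', mk_eq_mk_iff]
    refine ⟨a * x'.rep i / x.rep i, funext fun k => ?_⟩
    have := key i k
    simp only [Pi.smul_apply, smul_eq_mul]
    field_simp
    linear_combination this

lemma isClosed_segre {Z : Set (PSpace ι)} {W : Set (PSpace κ)} (hZ : IsClosed Z)
    (hW : IsClosed W) : IsClosed (segre '' (Z ×ˢ W)) := by
  rw [← isOpen_compl_iff, isOpen_iff_forall_mem_open]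
  intro w hw
  suffices H : ∃ (d : ℕ) (f : MvPolynomial (ι × κ) ℂ), f.IsHomogeneous d ∧
      MvPolynomial.eval w.rep f ≠ 0 ∧ ∀ x ∈ Z, ∀ y ∈ W,
        MvPolynomial.eval (fun ij : ι × κ => x.rep ij.1 * y.rep ij.2) f = 0 by
    obtain ⟨d, f, hf, h1, h2⟩ := H
    refine ⟨basicOpen f, ?_, isOpen_basicOpen hf, h1⟩
    rintro _ h ⟨⟨x, y⟩, ⟨hx, hy⟩, rfl⟩
    exact (mk_mem_basicOpen hf _ _).1 h (h2 x hx y hy)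
  by_cases hq : ∃ i j k l, w.rep (i, j) * w.rep (k, l) ≠ w.rep (i, l) * w.rep (k, j)
  · obtain ⟨i, j, k, l, h⟩ := hq
    refine ⟨1 + 1, .X (i, j) * .X (k, l) - .X (i, l) * .X (k, j), ?_, ?_, ?_⟩
    · exact ((MvPolynomial.isHomogeneous_X _ _).mul (MvPolynomial.isHomogeneous_X _ _)).sub
        ((MvPolynomial.isHomogeneous_X _ _).mul (MvPolynomial.isHomogeneous_X _ _))
    · simpa [sub_eq_zero] using h
    · intro x _ y _
      simp only [map_sub, map_mul, MvPolynomial.eval_X]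
      ring
  push Not at hq
  obtain ⟨⟨i, j⟩, hij⟩ := Function.ne_iff.1 w.rep_ne_zero
  simp only [Pi.zero_apply] at hij
  have hx : (fun k => w.rep (k, j)) ≠ 0 := Function.ne_iff.2 ⟨i, hij⟩
  have hy : (fun k => w.rep (i, k)) ≠ 0 := Function.ne_iff.2 ⟨j, hij⟩
  by_cases hxZ : mk _ hx ∈ Z
  · by_cases hyW : mk _ hy ∈ W
    · refine absurd ⟨(mk _ hx, mk _ hy), ⟨hxZ, hyW⟩, ?_⟩ hw
      obtain ⟨a, ha, h⟩ := exists_rep_mk _ hx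
      obtain ⟨b, hb, h'⟩ := exists_rep_mk _ hy
      conv_rhs => rw [← mk_rep w]
      refine (mk_eq_mk_iff _ _).2 ⟨a * b * w.rep (i, j), funext fun kl => ?_⟩
      simp only [h, h', Pi.smul_apply, smul_eq_mul]
      have := hq i j kl.1 kl.2
      linear_combination a * b * this
    · obtain ⟨d, f, hf, h1, h2⟩ := exists_of_notMem hW hyW
      refine ⟨d, MvPolynomial.rename (fun k => (i, k)) f, hf.rename_isHomogeneous, ?_, ?_⟩
      · rw [MvPolynomial.eval_rename]
        exact (mk_mem_basicOpen hf _ hy).1 h1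
      · intro x _ y hy
        rw [MvPolynomial.eval_rename]
        have := eval_smul hf (x.rep i) y.rep
        rw [h2 y hy, mul_zero] at this
        exact this
  · obtain ⟨d, f, hf, h1, h2⟩ := exists_of_notMem hZ hxZ
    refine ⟨d, MvPolynomial.rename (fun k => (k, j)) f, hf.rename_isHomogeneous, ?_, ?_⟩
    · rw [MvPolynomial.eval_rename]
      exact (mk_mem_basicOpen hf _ hx).1 h1
    · intro x hx y _
      rw [MvPolynomial.eval_rename]
      have := eval_smul hf (y.rep j) x.rep
      rw [h2 x hx, mul_zero] at this
      rw [← this]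
      congr 2
      exact funext fun k => mul_comm _ _

lemma isLocallyClosed_segre {X : Set (PSpace ι)} {Y : Set (PSpace κ)} (hX : IsLocallyClosed X)
    (hY : IsLocallyClosed Y) : IsLocallyClosed (segre '' (X ×ˢ Y)) := by
  obtain ⟨U, Z, hU, hZ, rfl⟩ := hX
  obtain ⟨V, W, hV, hW, rfl⟩ := hY
  refine ⟨(segre '' (Uᶜ ×ˢ Set.univ))ᶜ ∩ (segre '' (Set.univ ×ˢ Vᶜ))ᶜ, segre '' (Z ×ˢ W),
    (isClosed_segre hU.isClosed_compl isClosed_univ).isOpen_compl.inter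
      (isClosed_segre isClosed_univ hV.isClosed_compl).isOpen_compl, isClosed_segre hZ hW, ?_⟩
  ext w
  constructor
  · rintro ⟨⟨x, y⟩, ⟨⟨hxU, hxZ⟩, hyV, hyW⟩, rfl⟩
    refine ⟨⟨?_, ?_⟩, ⟨(x, y), ⟨hxZ, hyW⟩, rfl⟩⟩
    · rintro ⟨q, hq, h⟩
      rw [segre_injective h] at hq
      exact hq.1 hxU
    · rintro ⟨q, hq, h⟩
      rw [segre_injective h] at hq
      exact hq.2 hyV
  · rintro ⟨⟨h1, h2⟩, ⟨⟨x, y⟩, ⟨hx, hy⟩, rfl⟩⟩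
    refine ⟨(x, y), ⟨⟨by_contra fun h => h1 ⟨_, ⟨h, trivial⟩, rfl⟩, hx⟩,
      ⟨by_contra fun h => h2 ⟨_, ⟨trivial, h⟩, rfl⟩, hy⟩⟩, rfl⟩

end PSpace

/-! ### Quasi-projective varieties -/

/-- A complex quasi-projective variety (not necessarily irreducible): a Zariski locally closed
subset of a complex projective space. -/
structure QuasiProjVariety : Type 1 where
  index : Type
  finite_index : Finite index
  carrier : Set (PSpace index)
  isLocallyClosed : IsLocallyClosed carrier

namespace QuasiProjVariety

/-- A map between varieties is regular if near every point it is given by homogeneous polynomials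
of one and the same degree without a common zero. -/
def IsRegular {X Y : QuasiProjVariety} (φ : X.carrier → Y.carrier) : Prop :=
  ∀ x : X.carrier, ∃ U : Set (PSpace X.index), IsOpen U ∧ (x : PSpace X.index) ∈ U ∧
    ∃ (d : ℕ) (F : Y.index → MvPolynomial X.index ℂ), (∀ k, (F k).IsHomogeneous d) ∧
      ∀ u : X.carrier, (u : PSpace X.index) ∈ U →
        ∃ h : (fun k => MvPolynomial.eval (u : PSpace X.index).rep (F k)) ≠ 0,
          (φ u : PSpace Y.index) = PSpace.mk _ h

/-- Two varieties are isomorphic if there is a bijection that is regular in both directions. -/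
def Isomorphic (X Y : QuasiProjVariety) : Prop :=
  ∃ e : X.carrier ≃ Y.carrier, IsRegular (X := X) (Y := Y) e ∧ IsRegular (X := Y) (Y := X) e.symm

/-- The product of two varieties, embedded by the Segre embedding. -/
def prod (X Y : QuasiProjVariety) : QuasiProjVariety where
  index := X.index × Y.index
  finite_index := by
    have := X.finite_index
    have := Y.finite_index
    infer_instance
  carrier := PSpace.segre '' (X.carrier ×ˢ Y.carrier)
  isLocallyClosed := PSpace.isLocallyClosed_segre X.isLocallyClosed Y.isLocallyClosed

/-- The one-point variety `ℙ^0`. -/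
def point : QuasiProjVariety where
  index := Unit
  finite_index := inferInstance
  carrier := Set.univ
  isLocallyClosed := isClosed_univ.isLocallyClosed

end QuasiProjVariety

/-! ### The Grothendieck ring of complex quasi-projective varieties -/

open QuasiProjVariety in
/-- The relations of the Grothendieck ring: isomorphic varieties have the same class,
`[X] = [Y] + [X \ Y]` for a locally closed subset `Y` of `X` (such that `X \ Y` is a variety as
well), `[X × Y] = [X] [Y]`, and the class of a point is `1`. -/
inductive GrothendieckRel : MvPolynomial QuasiProjVariety ℤ → MvPolynomial QuasiProjVariety ℤ → Prop
  | iso (X Y : QuasiProjVariety) (h : Isomorphic X Y) :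
      GrothendieckRel (.X X) (.X Y)
  | scissor (ι : Type) (hι : Finite ι) (A B : Set (PSpace ι)) (hAB : B ⊆ A)
      (hA : IsLocallyClosed A) (hB : IsLocallyClosed B) (hC : IsLocallyClosed (A \ B)) :
      GrothendieckRel (.X ⟨ι, hι, A, hA⟩) (.X ⟨ι, hι, B, hB⟩ + .X ⟨ι, hι, A \ B, hC⟩)
  | prod (X Y : QuasiProjVariety) : GrothendieckRel (.X (X.prod Y)) (.X X * .X Y)
  | point : GrothendieckRel (.X point) 1

/-- The Grothendieck ring `K₀(𝒱_ℂ)` of complex quasi-projective varieties: the commutative ring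
generated by all varieties, modulo the relations above. -/
abbrev K0 : Type 1 :=
  MvPolynomial QuasiProjVariety ℤ ⧸ Ideal.span {r | ∃ a b, GrothendieckRel a b ∧ r = a - b}

/-- The class `[X]` in the Grothendieck ring. -/
def cls (X : QuasiProjVariety) : K0 := Ideal.Quotient.mk _ (MvPolynomial.X X)

/-! ### Algebraic tori -/

lemma cons_one_ne_zero {n : ℕ} (t : Fin n → ℂ) : (Fin.cons 1 t : Fin (n + 1) → ℂ) ≠ 0 :=
  Function.ne_iff.2 ⟨0, by simp⟩

/-- The set of the points `[1 : t_1 : ... : t_n]` with all `t_i ∈ ℂ^*`. -/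
def torusSet (n : ℕ) : Set (PSpace (Fin (n + 1))) :=
  Set.range fun t : Fin n → ℂˣ => PSpace.mk _ (cons_one_ne_zero fun i => (t i : ℂ))

lemma isOpen_torusSet (n : ℕ) : IsOpen (torusSet n) := by
  have h : torusSet n = ⋂ i : Fin (n + 1), PSpace.basicOpen (.X i) := by
    ext p
    constructor
    · rintro ⟨t, rfl⟩
      refine Set.mem_iInter.2 fun i => ?_
      rw [PSpace.mk_mem_basicOpen (MvPolynomial.isHomogeneous_X _ _), MvPolynomial.eval_X]
      refine Fin.cases ?_ (fun k => ?_) i <;> simp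
    · intro hp
      have hp' : ∀ i, p.rep i ≠ 0 := fun i => by
        simpa [PSpace.basicOpen] using Set.mem_iInter.1 hp i
      refine ⟨fun i => Units.mk0 (p.rep i.succ / p.rep 0) (div_ne_zero (hp' _) (hp' _)), ?_⟩
      conv_rhs => rw [← PSpace.mk_rep p]
      refine (PSpace.mk_eq_mk_iff _ _).2 ⟨(p.rep 0)⁻¹, funext fun i => ?_⟩
      have := hp' 0
      refine Fin.cases ?_ (fun k => ?_) i
      · simp [this]
      · simp [div_eq_inv_mul]
  rw [h]
  exact isOpen_iInter_of_finite fun i =>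
    PSpace.isOpen_basicOpen (MvPolynomial.isHomogeneous_X _ _)

/-- The algebraic torus `(ℂ^*)^n`, embedded in `ℙ^n` by `t ↦ [1 : t_1 : ... : t_n]`. -/
def torus (n : ℕ) : QuasiProjVariety where
  index := Fin (n + 1)
  finite_index := inferInstance
  carrier := torusSet n
  isLocallyClosed := (isOpen_torusSet n).isLocallyClosed

/-! ### Permutohedral varieties -/

/-- The permutohedron `π_m` of dimension `m - 1`: the convex hull in `ℝ^m` of the points obtained
from `(1, 2, ..., m)` by permuting the coordinates. -/
def permutohedron (m : ℕ) : Set (Fin m → ℝ) :=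
  convexHull ℝ (Set.range fun (σ : Equiv.Perm (Fin m)) (i : Fin m) => ((σ i : ℕ) : ℝ) + 1)

/-- The lattice points of a subset of `ℝ^m`. -/
def latticePoints {m : ℕ} (P : Set (Fin m → ℝ)) : Set (Fin m → ℤ) :=
  {a | (fun i => (a i : ℝ)) ∈ P}

lemma finite_latticePoints_permutohedron (m : ℕ) : (latticePoints (permutohedron m)).Finite := by
  refine (Set.finite_Icc (fun _ => 1 : Fin m → ℤ) (fun _ => m)).subset fun a ha => ?_
  have h : permutohedron m ⊆ Set.Icc (fun _ => 1) (fun _ => (m : ℝ)) := by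
    refine convexHull_min ?_ (convex_Icc _ _)
    rintro _ ⟨σ, rfl⟩
    refine ⟨fun i => by simp, fun i => ?_⟩
    have : ((σ i : ℕ) + 1 : ℕ) ≤ m := (σ i).2
    change ((σ i : ℕ) : ℝ) + 1 ≤ m
    exact_mod_cast this
  obtain ⟨h1, h2⟩ := h ha
  refine ⟨fun i => ?_, fun i => ?_⟩
  · have h : (1 : ℝ) ≤ a i := h1 i
    exact_mod_cast h
  · have h : (a i : ℝ) ≤ m := h2 i
    exact_mod_cast h

/-- The projective toric variety `X_A` of a set `A ⊆ ℤ^m` of characters of the torus `(ℂ^*)^m`: the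
Zariski closure of the set of the points `[t^a]_{a ∈ A}`, where `t ∈ (ℂ^*)^m` and
`t^a = ∏ i, t_i ^ a_i`. For the set of lattice points of a very ample lattice polytope it is the
toric variety of the polytope; a lattice polytope whose normal fan is smooth, such as the
permutohedron, is very ample (with respect to the lattice of its affine span). -/
def toricSet {m : ℕ} (A : Set (Fin m → ℤ)) : Set (PSpace A) :=
  closure {p | ∃ (t : Fin m → ℂˣ)
    (h : (fun a : A => ∏ i, (t i : ℂ) ^ ((a : Fin m → ℤ) i)) ≠ 0), p = PSpace.mk _ h}

/-- The permutohedral variety `X_Π^n`: the toric variety of the `n`-dimensional permutohedron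
`π_{n+1}`. -/
def permutohedralVariety (n : ℕ) : QuasiProjVariety where
  index := latticePoints (permutohedron (n + 1))
  finite_index := (finite_latticePoints_permutohedron (n + 1)).to_subtype
  carrier := toricSet (latticePoints (permutohedron (n + 1)))
  isLocallyClosed := isClosed_closure.isLocallyClosed

/-! ### The generating series -/

/-- The coefficient of `x^n / n!` in `π(x) = 1 + ∑_{n ≥ 1} [X_Π^{n-1}] x^n / n!`. -/
def permutohedralCoeff : ℕ → K0
  | 0 => 1
  | n + 1 => cls (permutohedralVariety n)

/-- The coefficient of `x^n / n!` in `τ(x) = 1 - ∑_{n ≥ 1} [(ℂ^*)^{n-1}] x^n / n!`. -/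
def torusCoeff : ℕ → K0
  | 0 => 1
  | n + 1 => -cls (torus n)

/-- The exponential generating series `∑ a_n x^n / n!` of a sequence in a commutative ring `R`. As
it has denominators, its coefficients are in `ℚ ⊗ R`. -/
def expSeries {R : Type*} [CommRing R] (a : ℕ → R) : PowerSeries (ℚ ⊗[ℤ] R) :=
  PowerSeries.mk fun n => (1 / (n.factorial : ℚ)) ⊗ₜ[ℤ] a n

end Motivic

end

/-!
The torus orbits of the permutohedral variety `X` of dimension `n` are tori, indexed by the ordered
set partitions of the `n + 1` coordinates: a partition into `r` blocks gives an orbit of dimension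
`n + 1 - r`. Additivity of the class gives `[X]` as a sum over ordered set partitions, and splitting
off the last block of the partition turns this sum into the recursion which says that the two
exponential generating series are inverse to each other.

The orbits are found without the general theory of toric varieties.

* At the vertex of a permutation `τ` the variety has an affine chart `ℂ^n`, in which all projective
  coordinates are monomials in the affine coordinates (`exists_eq_chart`, `chart_mem_toricSet`). The
  exponents are the values of the inequalities `∑ i ∈ S, a i ≥ 1 + ... + S.card` at the sets `S` of
  the flag of `τ`. So only the easy half of the description of the permutohedron by inequalities is
  needed.
* The charts cover `X` (`exists_vertex_ne_zero`): each lattice point has a positive multiple that is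
  a combination of vertices with coefficients in `ℕ`, and this gives a binomial equation of `X`.
* For every nonempty proper set `S` of coordinates there is a divisor, which in each chart is a
  coordinate hyperplane or empty (`chart_mem_divisor_iff`). The strata that these divisors cut out
  are empty, unless the sets `S` in question form a chain `C`, and then the stratum is a torus of
  dimension `n - C.card` (`clsSet_stratum`). Chains correspond to ordered set partitions.
* The identification with a torus is always an instance of `clsSet_eq_cls_torus`, on monomial
  parametrizations; it also gives `[(ℂ^*)^(m + n)] = [(ℂ^*)^m] [(ℂ^*)^n]`.
-/

noncomputable section

namespace Motivic

/-! ### Classes of locally closed sets -/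

lemma mk_eq_mk_of_rel {a b : MvPolynomial QuasiProjVariety ℤ} (h : GrothendieckRel a b) :
    (Ideal.Quotient.mk _ a : K0) = Ideal.Quotient.mk _ b :=
  Ideal.Quotient.eq.2 (Ideal.subset_span ⟨a, b, h, rfl⟩)

lemma cls_eq_of_isomorphic {X Y : QuasiProjVariety} (h : X.Isomorphic Y) : cls X = cls Y :=
  mk_eq_mk_of_rel (.iso X Y h)

lemma cls_prod (X Y : QuasiProjVariety) : cls (X.prod Y) = cls X * cls Y :=
  (mk_eq_mk_of_rel (.prod X Y)).trans (map_mul (Ideal.Quotient.mk _) _ _)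

lemma cls_point : cls .point = 1 :=
  (mk_eq_mk_of_rel .point).trans (map_one (Ideal.Quotient.mk _))

open Classical in
/-- The class of a locally closed subset of a projective space, with the value `0` on all other
sets. -/
def clsSet {ι : Type} [hι : Finite ι] (A : Set (PSpace ι)) : K0 :=
  if hA : IsLocallyClosed A then cls ⟨ι, hι, A, hA⟩ else 0

/-- The part of `A` that lies in exactly those sets of the family `D` (restricted to `J`) whose
index is in `C`. -/
def stratum {ι : Type} {s : Type*} (A : Set (PSpace ι)) (D : s → Set (PSpace ι)) (J C : Finset s) :
    Set (PSpace ι) :=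
  {p | p ∈ A ∧ ∀ j ∈ J, p ∈ D j ↔ j ∈ C}

lemma isLocallyClosed_stratum {ι : Type} {s : Type*} [DecidableEq s] {A : Set (PSpace ι)}
    (hA : IsLocallyClosed A) {D : s → Set (PSpace ι)} (hD : ∀ j, IsClosed (D j)) (J C : Finset s) :
    IsLocallyClosed (stratum A D J C) := by
  induction J using Finset.induction_on with
  | empty => simpa [stratum] using hA
  | insert j J _ ih =>
    by_cases hj : j ∈ C
    · convert ih.inter (hD j).isLocallyClosed using 1
      ext p
      simp [stratum, hj]
      tauto
    · convert ih.inter (hD j).isOpen_compl.isLocallyClosed using 1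
      ext p
      simp [stratum, hj]
      tauto

section

variable {ι : Type} [hι : Finite ι]

lemma clsSet_of_isLocallyClosed {A : Set (PSpace ι)} (hA : IsLocallyClosed A) :
    clsSet A = cls ⟨ι, hι, A, hA⟩ := dif_pos hA

lemma clsSet_eq_add {A B : Set (PSpace ι)} (hBA : B ⊆ A) (hA : IsLocallyClosed A)
    (hB : IsLocallyClosed B) (hC : IsLocallyClosed (A \ B)) :
    clsSet A = clsSet B + clsSet (A \ B) := by
  rw [clsSet_of_isLocallyClosed hA, clsSet_of_isLocallyClosed hB, clsSet_of_isLocallyClosed hC]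
  exact (mk_eq_mk_of_rel (.scissor ι hι A B hBA hA hB hC)).trans
    (map_add (Ideal.Quotient.mk _) _ _)

lemma clsSet_empty : clsSet (∅ : Set (PSpace ι)) = 0 := by
  have h := clsSet_eq_add (ι := ι) (A := ∅) (B := ∅) subset_rfl isClosed_empty.isLocallyClosed
    isClosed_empty.isLocallyClosed (by simpa using isClosed_empty.isLocallyClosed)
  simpa using h

/-- A finite family of closed sets cuts a locally closed set into strata, and the class is the sum
of the classes of the strata. -/
lemma clsSet_eq_sum_stratum {s : Type*} [DecidableEq s] {A : Set (PSpace ι)}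
    (hA : IsLocallyClosed A) {D : s → Set (PSpace ι)} (hD : ∀ j, IsClosed (D j)) (J : Finset s) :
    clsSet A = ∑ C ∈ J.powerset, clsSet (stratum A D J C) := by
  induction J using Finset.induction_on with
  | empty => simp [stratum]
  | insert j J hj ih =>
    rw [ih, Finset.sum_powerset_insert hj, add_comm, ← Finset.sum_add_distrib]
    refine Finset.sum_congr rfl fun C hC => ?_
    have hC' : j ∉ C := fun h => hj (Finset.mem_powerset.1 hC h)
    have e1 : stratum A D (insert j J) (insert j C) = stratum A D J C ∩ D j := by
      ext p
      simp only [stratum, Finset.mem_insert, Set.mem_ofPred_eq, Set.mem_inter_iff]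
      refine ⟨fun h => ⟨⟨h.1, fun i hi => ?_⟩, (h.2 j (.inl rfl)).2 (.inl rfl)⟩,
        fun h => ⟨h.1.1, fun i hi => ?_⟩⟩
      · rw [h.2 i (.inr hi)]
        exact or_iff_right fun h => hj (by rwa [h] at hi)
      · rcases hi with rfl | hi
        · simp [h.2]
        · rw [h.1.2 i hi]
          exact (or_iff_right fun h => hj (by rwa [h] at hi)).symm
    have e2 : stratum A D (insert j J) C = stratum A D J C \ (stratum A D J C ∩ D j) := by
      ext p
      simp only [stratum, Finset.mem_insert, Set.mem_ofPred_eq, Set.mem_inter_iff, Set.mem_sdiff]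
      refine ⟨fun h => ⟨⟨h.1, fun i hi => h.2 i (.inr hi)⟩,
        fun h' => hC' ((h.2 j (.inl rfl)).1 h'.2)⟩,
        fun h => ⟨h.1.1, fun i hi => ?_⟩⟩
      rcases hi with rfl | hi
      · simp only [hC', iff_false]
        exact fun h' => h.2 ⟨h.1, h'⟩
      · exact h.1.2 i hi
    rw [clsSet_eq_add (B := stratum A D J C ∩ D j) Set.inter_subset_left
      (isLocallyClosed_stratum hA hD J C), e1, e2]
    · rw [← e1]; exact isLocallyClosed_stratum hA hD _ _
    · rw [← e2]; exact isLocallyClosed_stratum hA hD _ _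

end

/-! ### Monomial parametrizations of tori -/

lemma PSpace.rep_mk_eq_zero_iff {ι : Type} {v : ι → ℂ} (hv : v ≠ 0) (i : ι) :
    (PSpace.mk v hv).rep i = 0 ↔ v i = 0 := by
  obtain ⟨a, ha, h⟩ := exists_rep_mk v hv
  simp [h, ha]

/-- A map that is given by one family of homogeneous polynomials is regular; the polynomials may be
evaluated at any homogeneous coordinates. -/
lemma isRegular_of_eval {ι κ : Type} [hι : Finite ι] [hκ : Finite κ] {A : Set (PSpace ι)}
    {B : Set (PSpace κ)} (hA : IsLocallyClosed A) (hB : IsLocallyClosed B) (φ : A → B) (d : ℕ)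
    (F : κ → MvPolynomial ι ℂ) (hF : ∀ k, (F k).IsHomogeneous d)
    (H : ∀ u : A, ∃ v hv w hw, ∃ c : ℂ, (u : PSpace ι) = PSpace.mk v hv ∧
      (φ u : PSpace κ) = PSpace.mk w hw ∧ c ≠ 0 ∧ ∀ k, MvPolynomial.eval v (F k) = c * w k) :
    QuasiProjVariety.IsRegular (X := ⟨ι, hι, A, hA⟩) (Y := ⟨κ, hκ, B, hB⟩) φ := by
  refine fun x => ⟨Set.univ, isOpen_univ, trivial, d, F, hF, fun u _ => ?_⟩
  obtain ⟨v, hv, w, hw, c, hu, hφ, hc, h⟩ := H u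
  obtain ⟨a, ha, hr⟩ := PSpace.exists_rep_mk v hv
  have key : (fun k => MvPolynomial.eval (u : PSpace ι).rep (F k)) = (a ^ d * c) • w := by
    funext k
    rw [hu, hr, PSpace.eval_smul (hF k), h, Pi.smul_apply, smul_eq_mul, mul_assoc]
  have hne : a ^ d * c ≠ 0 := mul_ne_zero (pow_ne_zero _ ha) hc
  refine ⟨by rw [key]; exact smul_ne_zero hne hw, ?_⟩
  rw [hφ, PSpace.mk_eq_mk_iff]
  exact ⟨(a ^ d * c)⁻¹, by rw [key, smul_smul, inv_mul_cancel₀ hne, one_smul]⟩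

/-- The vector of the monomials `∏ k, y k ^ e a k`. -/
def monomials {ι κ : Type} [Fintype κ] (e : ι → κ → ℕ) (y : κ → ℂ) (a : ι) : ℂ :=
  ∏ k, y k ^ e a k

lemma monomials_of_eq_zero {ι κ : Type} [Fintype κ] {e : ι → κ → ℕ} {a : ι} (h : e a = 0)
    (y : κ → ℂ) : monomials e y a = 1 := by
  simp [monomials, h]

lemma monomials_of_eq_single {ι κ : Type} [Fintype κ] [DecidableEq κ] {e : ι → κ → ℕ} {a : ι} {k : κ}
    (h : e a = Pi.single k 1) (y : κ → ℂ) : monomials e y a = y k := by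
  rw [monomials, Finset.prod_eq_single k]
  · simp [h]
  · intro l _ hl
    simp [h, hl]
  · simp

lemma monomials_ne_zero {ι κ : Type} [Fintype κ] {e : ι → κ → ℕ} {a : ι} (h : e a = 0)
    (y : κ → ℂ) : monomials e y ≠ 0 :=
  Function.ne_iff.2 ⟨a, by simp [monomials_of_eq_zero h]⟩

lemma monomials_eq_zero_iff {ι κ : Type} [Fintype κ] (e : ι → κ → ℕ) (y : κ → ℂ) (a : ι) :
    monomials e y a = 0 ↔ ∃ k, y k = 0 ∧ e a k ≠ 0 := by
  simp [monomials, Finset.prod_eq_zero_iff]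

/-- The points of projective space with coordinates `∏ k, y k ^ e a k`, where `y` runs over the
vectors whose support is `K`, form a torus of dimension `K.card` if the constant monomial `1` and
all the coordinates `y k` are among the monomials. -/
lemma clsSet_eq_cls_torus {ι κ : Type} [hι : Finite ι] [Fintype κ] [DecidableEq κ]
    (e : ι → κ → ℕ) (a₀ : ι) (ha₀ : e a₀ = 0) (a : κ → ι) (ha : ∀ k, e (a k) = Pi.single k 1)
    (K : Finset κ) {A : Set (PSpace ι)} (hA : IsLocallyClosed A)
    (hAe : A = {p | ∃ y : κ → ℂ, (∀ k, y k ≠ 0 ↔ k ∈ K) ∧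
      p = PSpace.mk (monomials e y) (monomials_ne_zero ha₀ y)}) :
    clsSet A = cls (torus K.card) := by
  classical
  have := Fintype.ofFinite ι
  rw [clsSet_of_isLocallyClosed hA]
  apply cls_eq_of_isomorphic
  set T := Fin K.card → ℂˣ
  let E : K ≃ Fin K.card := K.equivFin
  let ext : T → κ → ℂ := fun t k => if h : k ∈ K then (t (E ⟨k, h⟩) : ℂ) else 0
  have ext_ne : ∀ t k, ext t k ≠ 0 ↔ k ∈ K := by
    intro t k
    by_cases h : k ∈ K <;> simp [ext, h]
  have ext_E : ∀ t j, ext t (E.symm j) = t j := by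
    intro t j
    simp [ext]
  let f : T → A := fun t => ⟨PSpace.mk (monomials e (ext t)) (monomials_ne_zero ha₀ _), by
    rw [hAe]; exact ⟨ext t, ext_ne t, rfl⟩⟩
  let g : T → torusSet K.card := fun t => ⟨PSpace.mk _ (cons_one_ne_zero fun i => (t i : ℂ)), t, rfl⟩
  have hf : Function.Bijective f := by
    constructor
    · intro t t' h
      obtain ⟨c, hc⟩ := (PSpace.mk_eq_mk_iff _ _).1 (congrArg Subtype.val h)
      have h1 : c = 1 := by simpa [monomials_of_eq_zero ha₀] using congrFun hc a₀
      funext j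
      have := congrFun hc (a (E.symm j))
      simp only [h1, one_smul, monomials_of_eq_single (ha _), ext_E] at this
      exact Units.ext this.symm
    · rintro ⟨p, hp⟩
      have hp' := hp
      rw [hAe] at hp'
      obtain ⟨y, hy, rfl⟩ := hp'
      refine ⟨fun j => Units.mk0 (y (E.symm j)) ((hy _).2 (E.symm j).2), Subtype.ext ?_⟩
      simp only [f]
      congr 2
      funext k
      by_cases h : k ∈ K
      · simp [ext, h]
      · simpa [ext, h, eq_comm] using (not_iff_not.2 (hy k)).2 h
  have hg : Function.Bijective g := by
    constructor
    · intro t t' h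
      obtain ⟨c, hc⟩ := (PSpace.mk_eq_mk_iff _ _).1 (congrArg Subtype.val h)
      have h1 : c = 1 := by simpa using congrFun hc 0
      funext j
      have := congrFun hc j.succ
      simp only [h1, one_smul, Fin.cons_succ] at this
      exact Units.ext this.symm
    · rintro ⟨_, t, rfl⟩
      exact ⟨t, rfl⟩
  let φ : A ≃ torusSet K.card := (Equiv.ofBijective f hf).symm.trans (Equiv.ofBijective g hg)
  have φf : ∀ t, φ (f t) = g t := fun t => by
    simp only [φ, Equiv.trans_apply]
    rw [show (Equiv.ofBijective f hf).symm (f t) = t from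
      (Equiv.ofBijective f hf).symm_apply_apply t]
    rfl
  have φg : ∀ t, φ.symm (g t) = f t := fun t => by rw [Equiv.symm_apply_eq, φf]
  refine ⟨φ, ?_, ?_⟩
  · refine isRegular_of_eval hA (isOpen_torusSet K.card).isLocallyClosed φ 1
      (Fin.cons (.X a₀) fun j => .X (a (E.symm j))) ?_ ?_
    · exact Fin.cases (MvPolynomial.isHomogeneous_X _ _) fun j => MvPolynomial.isHomogeneous_X _ _
    · intro u
      obtain ⟨t, rfl⟩ := hf.2 u
      refine ⟨_, _, _, _, 1, rfl, congrArg Subtype.val (φf t), one_ne_zero,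
        Fin.cases ?_ fun j => ?_⟩
      · simp [monomials_of_eq_zero ha₀]
      · simp [monomials_of_eq_single (ha _), ext_E]
  · -- A monomial of degree `s` in the affine coordinates is multiplied by `X 0 ^ (N - s)`.
    let N := ∑ b, ∑ j, e b (E.symm j)
    have hN : ∀ b, ∑ j, e b (E.symm j) ≤ N := fun b =>
      Finset.single_le_sum (f := fun b => ∑ j, e b (E.symm j)) (fun _ _ => Nat.zero_le _)
        (Finset.mem_univ b)
    let F : ι → MvPolynomial (Fin (K.card + 1)) ℂ := fun b =>
      if ∃ k, k ∉ K ∧ e b k ≠ 0 then 0 else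
        MvPolynomial.X 0 ^ (N - ∑ j, e b (E.symm j)) *
          ∏ j : Fin K.card, MvPolynomial.X j.succ ^ e b (E.symm j)
    refine isRegular_of_eval (isOpen_torusSet K.card).isLocallyClosed hA φ.symm N F ?_ ?_
    · intro b
      by_cases h : ∃ k, k ∉ K ∧ e b k ≠ 0
      · simp only [F, if_pos h]
        exact MvPolynomial.isHomogeneous_zero _ _ _
      · simp only [F, if_neg h]
        have := ((MvPolynomial.isHomogeneous_X ℂ (0 : Fin (K.card + 1))).pow
          (N - ∑ j, e b (E.symm j))).mul (MvPolynomial.IsHomogeneous.prod Finset.univ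
          (fun j : Fin K.card => MvPolynomial.X (R := ℂ) j.succ ^ e b (E.symm j))
          (fun j => 1 * e b (E.symm j)) fun j _ => (MvPolynomial.isHomogeneous_X ℂ _).pow _)
        simpa [Nat.sub_add_cancel (hN b)] using this
    · intro u
      obtain ⟨t, rfl⟩ := hg.2 u
      refine ⟨_, _, _, _, 1, rfl, congrArg Subtype.val (φg t), one_ne_zero, fun b => ?_⟩
      rw [one_mul]
      by_cases h : ∃ k, k ∉ K ∧ e b k ≠ 0
      · simp only [F, if_pos h, map_zero]
        obtain ⟨k, hk, hb⟩ := h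
        exact ((monomials_eq_zero_iff _ _ _).2
          ⟨k, not_not.1 ((not_iff_not.2 (ext_ne t k)).2 hk), hb⟩).symm
      · simp only [F, if_neg h]
        push Not at h
        have h1 : monomials e (ext t) b = ∏ k ∈ K, ext t k ^ e b k := by
          refine (Finset.prod_subset (Finset.subset_univ K) fun k _ hk => ?_).symm
          rw [h k hk, pow_zero]
        rw [h1, ← Finset.prod_coe_sort K, ← E.symm.prod_comp]
        simp [ext_E]

lemma cls_torus_add (m n : ℕ) : cls (torus (m + n)) = cls (torus m) * cls (torus n) := by
  classical
  rw [← cls_prod]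
  have h := clsSet_eq_cls_torus (ι := Fin (m + 1) × Fin (n + 1)) (κ := Fin m ⊕ Fin n)
    (e := fun ij : Fin (m + 1) × Fin (n + 1) => Sum.elim (fun k => if ij.1 = k.succ then 1 else 0)
      (fun k => if ij.2 = k.succ then 1 else 0)) (0, 0)
    (by funext k; rcases k with k | k <;> simp [(Fin.succ_ne_zero _).symm])
    (Sum.elim (fun k => (k.succ, 0)) (fun k => (0, k.succ)))
    (by
      rintro (k | k) <;> funext l <;> rcases l with l | l <;>
        simp [(Fin.succ_ne_zero _).symm, Pi.single_apply, eq_comm])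
    Finset.univ (A := ((torus m).prod (torus n)).carrier) ((torus m).prod (torus n)).isLocallyClosed
    ?_
  · rw [clsSet_of_isLocallyClosed (ι := Fin (m + 1) × Fin (n + 1))
      ((torus m).prod (torus n)).isLocallyClosed] at h
    simp only [Finset.card_univ, Fintype.card_sum, Fintype.card_fin] at h
    exact h.symm
  · have key : ∀ (t : Fin m → ℂ) (s : Fin n → ℂ) (ij : Fin (m + 1) × Fin (n + 1)),
        (Fin.cons 1 t : Fin (m + 1) → ℂ) ij.1 * (Fin.cons 1 s : Fin (n + 1) → ℂ) ij.2 =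
        monomials (fun ij : Fin (m + 1) × Fin (n + 1) =>
          Sum.elim (fun k => if ij.1 = k.succ then 1 else 0)
          (fun k => if ij.2 = k.succ then 1 else 0)) (Sum.elim t s) ij := by
      rintro t s ⟨i, j⟩
      simp only [monomials, Fintype.prod_sum_type, Sum.elim_inl, Sum.elim_inr]
      congr 1
      · refine Fin.cases ?_ (fun i => ?_) i
        · simp [(Fin.succ_ne_zero _).symm]
        · simp [pow_ite, Finset.prod_ite_eq]
      · refine Fin.cases ?_ (fun i => ?_) j
        · simp [(Fin.succ_ne_zero _).symm]
        · simp [pow_ite, Finset.prod_ite_eq]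
    have seg : ∀ (t : Fin m → ℂ) (s : Fin n → ℂ) (h : _),
        PSpace.segre (PSpace.mk _ (cons_one_ne_zero t), PSpace.mk _ (cons_one_ne_zero s)) =
        PSpace.mk (monomials (fun ij : Fin (m + 1) × Fin (n + 1) =>
          Sum.elim (fun k => if ij.1 = k.succ then 1 else 0)
          (fun k => if ij.2 = k.succ then 1 else 0)) (Sum.elim t s)) h := by
      intro t s h
      obtain ⟨a, ha, h1⟩ := PSpace.exists_rep_mk _ (cons_one_ne_zero t)
      obtain ⟨b, hb, h2⟩ := PSpace.exists_rep_mk _ (cons_one_ne_zero s)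
      refine (PSpace.mk_eq_mk_iff _ _).2 ⟨a * b, funext fun ij => ?_⟩
      simp only [h1, h2, Pi.smul_apply, smul_eq_mul, ← key]
      ring
    ext p
    constructor
    · rintro ⟨⟨_, _⟩, ⟨⟨t, rfl⟩, ⟨s, rfl⟩⟩, rfl⟩
      refine ⟨Sum.elim (fun i => (t i : ℂ)) (fun i => (s i : ℂ)), ?_, seg _ _ _⟩
      rintro (k | k) <;> simp
    · rintro ⟨y, hy, rfl⟩
      refine ⟨(_, _), ⟨⟨fun i => Units.mk0 (y (.inl i)) ((hy _).2 (Finset.mem_univ _)), rfl⟩,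
        ⟨fun i => Units.mk0 (y (.inr i)) ((hy _).2 (Finset.mem_univ _)), rfl⟩⟩, ?_⟩
      have : y = Sum.elim (fun i => y (.inl i)) (fun i => y (.inr i)) := by
        funext k; rcases k with k | k <;> rfl
      have hs := seg (fun i => y (.inl i)) (fun i => y (.inr i)) (by
        rw [← this]; exact monomials_ne_zero (a := (0, 0))
          (by funext k; rcases k with k | k <;> simp [(Fin.succ_ne_zero _).symm]) y)
      simp only [← this] at hs
      exact hs

lemma cls_torus_zero : cls (torus 0) = 1 := by
  classical
  rw [← cls_point]
  have h := clsSet_eq_cls_torus (ι := Unit) (κ := Empty) (e := fun _ => 0) () rfl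
    (fun k => k.elim) (fun k => k.elim) ∅ (A := Set.univ) isClosed_univ.isLocallyClosed ?_
  · rw [clsSet_of_isLocallyClosed isClosed_univ.isLocallyClosed] at h
    exact h.symm
  · refine (Set.eq_univ_of_forall fun p =>
      show ∃ y : Empty → ℂ, _ from ⟨fun k => k.elim, fun k => k.elim, ?_⟩).symm
    conv_lhs => rw [← PSpace.mk_rep p]
    exact (PSpace.mk_eq_mk_iff _ _).2 ⟨p.rep (), by funext i; simp [monomials]⟩

/-! ### Lattice points of the permutohedron -/

/-- The comparison of a finite set of natural numbers with the initial segment of the same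
cardinality; all terms on the right are nonnegative, and those of the last sum are positive. -/
lemma sum_sub_sum_range (T : Finset ℕ) :
    ∑ j ∈ T, (j : ℤ) - ∑ j ∈ Finset.range T.card, (j : ℤ) =
      ∑ j ∈ T \ Finset.range T.card, ((j : ℤ) - T.card) +
        ∑ j ∈ Finset.range T.card \ T, ((T.card : ℤ) - j) := by
  have h1 := Finset.sum_sdiff_sub_sum_sdiff (s₁ := T) (s₂ := Finset.range T.card)
    (f := fun j : ℕ => (j : ℤ) - T.card)
  simp only [Finset.sum_sub_distrib, Finset.sum_const, Finset.card_range, nsmul_eq_mul] at h1 ⊢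
  linarith

lemma sum_range_card_le (T : Finset ℕ) : ∑ j ∈ Finset.range T.card, (j : ℤ) ≤ ∑ j ∈ T, (j : ℤ) := by
  rw [← sub_nonneg, sum_sub_sum_range]
  refine add_nonneg (Finset.sum_nonneg fun j hj => ?_) (Finset.sum_nonneg fun j hj => ?_) <;>
  · simp only [Finset.mem_sdiff, Finset.mem_range] at hj
    omega

lemma eq_range_of_sum_eq {T : Finset ℕ}
    (h : ∑ j ∈ T, (j : ℤ) = ∑ j ∈ Finset.range T.card, (j : ℤ)) : T = Finset.range T.card := by
  rw [← sub_eq_zero, sum_sub_sum_range] at h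
  have h1 : 0 ≤ ∑ j ∈ T \ Finset.range T.card, ((j : ℤ) - T.card) :=
    Finset.sum_nonneg fun j hj => by
      simp only [Finset.mem_sdiff, Finset.mem_range] at hj
      omega
  have h2 : ∀ j ∈ Finset.range T.card \ T, 1 ≤ (T.card : ℤ) - j := fun j hj => by
    simp only [Finset.mem_sdiff, Finset.mem_range] at hj
    omega
  have h3 := Finset.card_nsmul_le_sum _ _ _ h2
  have h4 : (Finset.range T.card \ T).card = 0 := by
    simp only [nsmul_eq_mul, mul_one] at h3
    omega
  rw [Finset.card_eq_zero, Finset.sdiff_eq_empty_iff_subset] at h4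
  exact (Finset.eq_of_subset_of_card_le h4 (by simp)).symm

variable {n : ℕ}

/-- The amount by which the sum of the coordinates `a i`, `i ∈ S`, exceeds the least value
`1 + 2 + ... + S.card` that it takes on the permutohedron. The faces of the permutohedron are cut
out by the vanishing of such functions. -/
def defect (a : Fin (n + 1) → ℤ) (S : Finset (Fin (n + 1))) : ℤ :=
  ∑ i ∈ S, a i - ∑ j ∈ Finset.range S.card, ((j : ℤ) + 1)

/-- The vertex `(σ 0 + 1, ..., σ n + 1)` of the permutohedron. -/
def vertex (σ : Equiv.Perm (Fin (n + 1))) : latticePoints (permutohedron (n + 1)) :=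
  ⟨fun i => ((σ i : ℕ) : ℤ) + 1, subset_convexHull ℝ _ ⟨σ, by funext i; simp⟩⟩

lemma vertex_apply (σ : Equiv.Perm (Fin (n + 1))) (i : Fin (n + 1)) :
    (vertex σ : Fin (n + 1) → ℤ) i = ((σ i : ℕ) : ℤ) + 1 := rfl

lemma defect_vertex (σ : Equiv.Perm (Fin (n + 1))) (S : Finset (Fin (n + 1))) :
    defect (vertex σ : Fin (n + 1) → ℤ) S =
      ∑ j ∈ S.map (σ.toEmbedding.trans Fin.valEmbedding), (j : ℤ) -
        ∑ j ∈ Finset.range (S.map (σ.toEmbedding.trans Fin.valEmbedding)).card, (j : ℤ) := by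
  simp [defect, vertex_apply, Finset.sum_add_distrib]

lemma defect_vertex_eq_zero_iff (σ : Equiv.Perm (Fin (n + 1))) (S : Finset (Fin (n + 1))) :
    defect (vertex σ : Fin (n + 1) → ℤ) S = 0 ↔ S = Finset.univ.filter fun i => (σ i : ℕ) < S.card := by
  rw [defect_vertex, sub_eq_zero]
  constructor
  · intro h
    have h' := eq_range_of_sum_eq h
    ext i
    have := Finset.ext_iff.1 h' (σ i)
    simpa [Fin.val_inj] using this
  · intro h
    congr 1
    refine Finset.eq_of_subset_of_card_le (fun j hj => ?_) (by simp)
    simp only [Finset.mem_map, Function.Embedding.trans_apply] at hj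
    obtain ⟨i, hi, rfl⟩ := hj
    rw [h] at hi
    simpa using hi

lemma sum_le_of_mem_permutohedron {x : Fin (n + 1) → ℝ} (hx : x ∈ permutohedron (n + 1))
    (S : Finset (Fin (n + 1))) : ∑ j ∈ Finset.range S.card, ((j : ℝ) + 1) ≤ ∑ i ∈ S, x i := by
  have hconv : Convex ℝ {x : Fin (n + 1) → ℝ |
      ∑ j ∈ Finset.range S.card, ((j : ℝ) + 1) ≤ ∑ i ∈ S, x i} :=
    convex_halfSpace_ge (f := fun x : Fin (n + 1) → ℝ => ∑ i ∈ S, x i)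
      ⟨fun x y => by simp [Finset.sum_add_distrib], fun c x => by simp [Finset.mul_sum]⟩ _
  refine convexHull_min ?_ hconv hx
  rintro _ ⟨σ, rfl⟩
  have h := sum_range_card_le (S.map (σ.toEmbedding.trans Fin.valEmbedding))
  rw [← sub_nonneg, ← defect_vertex, defect, sub_nonneg] at h
  simp only [Set.mem_ofPred_eq]
  simp only [vertex_apply] at h
  exact_mod_cast h

lemma sum_eq_of_mem_permutohedron {x : Fin (n + 1) → ℝ} (hx : x ∈ permutohedron (n + 1)) :
    ∑ i, x i = ∑ j ∈ Finset.range (n + 1), ((j : ℝ) + 1) := by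
  have hconv : Convex ℝ {x : Fin (n + 1) → ℝ |
      ∑ i, x i = ∑ j ∈ Finset.range (n + 1), ((j : ℝ) + 1)} :=
    convex_hyperplane (f := fun x : Fin (n + 1) → ℝ => ∑ i, x i)
      ⟨fun x y => by simp [Finset.sum_add_distrib], fun c x => by simp [Finset.mul_sum]⟩ _
  refine convexHull_min ?_ hconv hx
  rintro _ ⟨σ, rfl⟩
  simp only [Set.mem_ofPred_eq]
  rw [Equiv.sum_comp σ fun i : Fin (n + 1) => ((i : ℕ) : ℝ) + 1]
  exact Fin.sum_univ_eq_sum_range (fun j : ℕ => (j : ℝ) + 1) (n + 1)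

lemma defect_nonneg (a : latticePoints (permutohedron (n + 1))) (S : Finset (Fin (n + 1))) :
    0 ≤ defect (a : Fin (n + 1) → ℤ) S := by
  have h := sum_le_of_mem_permutohedron a.2 S
  rw [defect, sub_nonneg]
  exact_mod_cast h

lemma defect_univ (a : latticePoints (permutohedron (n + 1))) :
    defect (a : Fin (n + 1) → ℤ) Finset.univ = 0 := by
  have h := sum_eq_of_mem_permutohedron a.2
  rw [defect, sub_eq_zero, Finset.card_fin]
  exact_mod_cast h

/-! ### The affine chart at a vertex -/

/-- The set of the `k + 1` indices at which the permutation takes its least values. -/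
def flagSet (τ : Equiv.Perm (Fin (n + 1))) (k : Fin n) : Finset (Fin (n + 1)) :=
  Finset.univ.filter fun i => τ i ≤ k.castSucc

lemma flagSet_eq_map (τ : Equiv.Perm (Fin (n + 1))) (k : Fin n) :
    flagSet τ k = (Finset.Iic k.castSucc).map τ.symm.toEmbedding := by
  ext i
  simp [flagSet]

lemma card_flagSet (τ : Equiv.Perm (Fin (n + 1))) (k : Fin n) : (flagSet τ k).card = k + 1 := by
  simp [flagSet_eq_map]

lemma flagSet_injective (τ : Equiv.Perm (Fin (n + 1))) : Function.Injective (flagSet τ) := by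
  intro k l h
  have := congrArg Finset.card h
  rw [card_flagSet, card_flagSet] at this
  exact Fin.ext (by omega)

lemma defect_flagSet (τ : Equiv.Perm (Fin (n + 1))) (a : Fin (n + 1) → ℤ) (k : Fin n) :
    defect a (flagSet τ k) =
      ∑ j, if j ≤ k.castSucc then a (τ.symm j) - ((j : ℕ) + 1) else 0 := by
  have h : ∑ j ∈ Finset.range ((k : ℕ) + 1), ((j : ℤ) + 1) =
      ∑ j ∈ Finset.Iic k.castSucc, (((j : ℕ) : ℤ) + 1) := by
    symm
    refine Finset.sum_bij (fun j _ => (j : ℕ)) ?_ ?_ ?_ ?_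
    · intro j hj
      simp only [Finset.mem_Iic, Fin.le_def, Fin.val_castSucc] at hj
      simpa using Nat.lt_succ_of_le hj
    · exact fun i _ j _ h => Fin.ext h
    · intro j hj
      rw [Finset.mem_range] at hj
      refine ⟨⟨j, by omega⟩, ?_, rfl⟩
      simp only [Finset.mem_Iic, Fin.le_def, Fin.val_castSucc]
      omega
    · exact fun _ _ => rfl
  rw [defect, card_flagSet, h, flagSet_eq_map, Finset.sum_map, ← Finset.sum_sub_distrib,
    ← Finset.sum_filter]
  refine Finset.sum_congr ?_ fun _ _ => rfl
  ext; simp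

/-- The exponents of the affine coordinates at the vertex `τ` in the coordinate `a` of projective
space: `a - vertex τ` is the sum of these multiples of the edge directions at `vertex τ`. -/
def chartExp (τ : Equiv.Perm (Fin (n + 1))) (a : latticePoints (permutohedron (n + 1)))
    (k : Fin n) : ℕ :=
  (defect (a : Fin (n + 1) → ℤ) (flagSet τ k)).toNat

lemma natCast_chartExp (τ : Equiv.Perm (Fin (n + 1))) (a : latticePoints (permutohedron (n + 1)))
    (k : Fin n) : (chartExp τ a k : ℤ) = defect (a : Fin (n + 1) → ℤ) (flagSet τ k) :=
  Int.toNat_of_nonneg (defect_nonneg _ _)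

lemma chartExp_vertex_self (τ : Equiv.Perm (Fin (n + 1))) : chartExp τ (vertex τ) = 0 := by
  funext k
  rw [← Int.natCast_inj, natCast_chartExp, defect_flagSet]
  simp [vertex_apply]

/-- The vertex adjacent to `vertex τ` along the `k`-th edge. -/
def adjVertex (τ : Equiv.Perm (Fin (n + 1))) (k : Fin n) :
    latticePoints (permutohedron (n + 1)) :=
  vertex (τ.trans (Equiv.swap k.castSucc k.succ))

lemma chartExp_adjVertex (τ : Equiv.Perm (Fin (n + 1))) (k : Fin n) :
    chartExp τ (adjVertex τ k) = Pi.single k 1 := by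
  have hs : ∀ j : Fin (n + 1), ((Equiv.swap k.castSucc k.succ j : ℕ) : ℤ) =
      (j : ℕ) + (if j = k.castSucc then 1 else 0) - (if j = k.succ then 1 else 0) := by
    intro j
    have hk : k.castSucc ≠ k.succ := Fin.castSucc_lt_succ.ne
    by_cases h1 : j = k.castSucc
    · subst h1; simp [hk]
    · by_cases h2 : j = k.succ
      · subst h2; simp [hk.symm]
      · simp [Equiv.swap_apply_of_ne_of_ne h1 h2, h1, h2]
  funext l
  rw [← Int.natCast_inj, natCast_chartExp, defect_flagSet]
  have : ∀ j : Fin (n + 1), (if j ≤ l.castSucc then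
      (adjVertex τ k : Fin (n + 1) → ℤ) (τ.symm j) - ((j : ℕ) + 1) else 0) =
      (if j = k.castSucc then (if j ≤ l.castSucc then 1 else 0) else 0) -
      (if j = k.succ then (if j ≤ l.castSucc then 1 else 0) else 0) := by
    intro j
    simp only [adjVertex, vertex_apply, Equiv.trans_apply, Equiv.apply_symm_apply, hs]
    split_ifs <;> ring
  simp only [this, Finset.sum_sub_distrib, Finset.sum_ite_eq', Finset.mem_univ, if_true,
    Pi.single_apply]
  have e1 : k.castSucc ≤ l.castSucc ↔ (k : ℕ) ≤ l := Iff.rfl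
  have e2 : k.succ ≤ l.castSucc ↔ (k : ℕ) + 1 ≤ l := Iff.rfl
  have e3 : l = k ↔ (l : ℕ) = k := Fin.ext_iff
  simp only [e1, e2, e3]
  split_ifs <;> first | rfl | omega

/-- Summation by parts, in multiplicative form. -/
lemma prod_zpow_eq {G : Type*} [CommGroup G] (u : Fin (n + 1) → G) (b : Fin (n + 1) → ℤ) :
    ∏ j, u j ^ b j = u (Fin.last n) ^ (∑ j, b j) *
      ∏ k : Fin n, (u k.castSucc / u k.succ) ^ (∑ j, if j ≤ k.castSucc then b j else 0) := by
  induction n with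
  | zero => simp
  | succ n ih =>
    rw [Fin.prod_univ_castSucc, ih (fun j => u j.castSucc) fun j => b j.castSucc,
      Fin.prod_univ_castSucc (n := n)]
    simp only [Fin.sum_univ_castSucc (n := n + 1), Fin.castSucc_le_castSucc_iff, Fin.succ_castSucc,
      Fin.succ_last]
    have h1 : ∀ k : Fin (n + 1), ¬ Fin.last (n + 1) ≤ k.castSucc := fun k =>
      not_le.2 (Fin.castSucc_lt_last k)
    have h2 : ∀ k : Fin (n + 1), k ≤ Fin.last n := Fin.le_last
    simp only [h1, h2, if_true, if_false, add_zero, div_zpow, zpow_add]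
    generalize u (Fin.last (n + 1)) ^ (∑ j : Fin (n + 1), b j.castSucc) = x
    generalize u (Fin.last n).castSucc ^ (∑ j : Fin (n + 1), b j.castSucc) = y
    generalize u (Fin.last (n + 1)) ^ b (Fin.last (n + 1)) = z
    generalize (∏ k : Fin n, _ : G) = q
    calc y * q * z = x * (y / x) * q * z := by rw [mul_div_cancel]
      _ = x * z * (q * (y / x)) := by ac_rfl

/-- The character `t ^ a` of the torus. -/
def character (t : Fin (n + 1) → ℂˣ) (a : latticePoints (permutohedron (n + 1))) : ℂ :=
  ∏ i, (t i : ℂ) ^ ((a : Fin (n + 1) → ℤ) i)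

lemma character_ne_zero (t : Fin (n + 1) → ℂˣ) (a : latticePoints (permutohedron (n + 1))) :
    character t a ≠ 0 :=
  Finset.prod_ne_zero_iff.2 fun i _ => zpow_ne_zero _ (t i).ne_zero

/-- In the affine chart at `τ`, the characters are monomials in the ratios of consecutive torus
coordinates. -/
lemma character_eq (τ : Equiv.Perm (Fin (n + 1))) (t : Fin (n + 1) → ℂˣ) (y : Fin n → ℂ)
    (hy : ∀ k : Fin n, y k = t (τ.symm k.castSucc) / t (τ.symm k.succ))
    (a : latticePoints (permutohedron (n + 1))) :
    character t a = character t (vertex τ) * monomials (chartExp τ) y a := by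
  have h := prod_zpow_eq (fun j => t (τ.symm j))
    fun j => (a : Fin (n + 1) → ℤ) (τ.symm j) - ((j : ℕ) + 1)
  have h0 : ∑ j, ((a : Fin (n + 1) → ℤ) (τ.symm j) - (((j : ℕ) : ℤ) + 1)) = 0 := by
    have := defect_univ a
    rw [Finset.sum_sub_distrib, τ.symm.sum_comp fun i => (a : Fin (n + 1) → ℤ) i]
    rw [defect, Finset.card_fin] at this
    rwa [Fin.sum_univ_eq_sum_range (fun j : ℕ => (j : ℤ) + 1) (n + 1)]
  simp only [← defect_flagSet, h0, zpow_zero, one_mul, zpow_sub, ← natCast_chartExp,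
    Finset.prod_mul_distrib, Finset.prod_inv_distrib, zpow_natCast] at h
  rw [mul_inv_eq_iff_eq_mul, mul_comm] at h
  have h' := congrArg (Units.val) h
  simp only [Units.val_mul, Units.coe_prod, Units.val_pow_eq_pow_val, Units.val_zpow_eq_zpow_val,
    Units.val_div_eq_div_val, ← hy] at h'
  rw [character, ← τ.symm.prod_comp, h', character,
    ← τ.symm.prod_comp fun i => (t i : ℂ) ^ (vertex τ : Fin (n + 1) → ℤ) i]
  simp [vertex_apply, monomials]

/-- A homogeneous polynomial that vanishes on the torus vanishes on the toric variety. -/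
lemma eval_eq_zero_of_mem_toricSet {f : MvPolynomial (latticePoints (permutohedron (n + 1))) ℂ}
    {d : ℕ} (hf : f.IsHomogeneous d) (h : ∀ t, MvPolynomial.eval (character t) f = 0)
    {p : PSpace (latticePoints (permutohedron (n + 1)))}
    (hp : p ∈ toricSet (latticePoints (permutohedron (n + 1)))) :
    MvPolynomial.eval p.rep f = 0 := by
  by_contra hne
  obtain ⟨_, hq, t, ht, rfl⟩ := mem_closure_iff.1 hp _ (PSpace.isOpen_basicOpen hf) hne
  exact (PSpace.mk_mem_basicOpen hf _ _).1 hq (h t)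

/-- The point with affine coordinates `y` in the chart at the vertex `τ`. -/
def chart (τ : Equiv.Perm (Fin (n + 1))) (y : Fin n → ℂ) :
    PSpace (latticePoints (permutohedron (n + 1))) :=
  PSpace.mk (monomials (chartExp τ) y) (monomials_ne_zero (chartExp_vertex_self τ) y)

/-- In homogeneous coordinates, the chart is described by the binomial equations
`X_a X_τ ^ N = X_τ ∏ k, X_{τ_k} ^ chartExp τ a k` with `N = ∑ k, chartExp τ a k`, where `τ_k` are the
adjacent vertices. They hold on the torus, hence on its closure. -/
lemma exists_eq_chart {p : PSpace (latticePoints (permutohedron (n + 1)))}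
    (hp : p ∈ toricSet (latticePoints (permutohedron (n + 1)))) {τ : Equiv.Perm (Fin (n + 1))}
    (hτ : p.rep (vertex τ) ≠ 0) : ∃ y, p = chart τ y := by
  refine ⟨fun k => p.rep (adjVertex τ k) / p.rep (vertex τ), ?_⟩
  conv_lhs => rw [← PSpace.mk_rep p]
  refine (PSpace.mk_eq_mk_iff _ _).2 ⟨p.rep (vertex τ), funext fun a => ?_⟩
  let N := ∑ k, chartExp τ a k
  have hom : (MvPolynomial.X a * MvPolynomial.X (vertex τ) ^ N - MvPolynomial.X (vertex τ) *
      ∏ k, MvPolynomial.X (adjVertex τ k) ^ chartExp τ a k :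
      MvPolynomial (latticePoints (permutohedron (n + 1))) ℂ).IsHomogeneous (1 + N) := by
    refine ((MvPolynomial.isHomogeneous_X _ _).mul ?_).sub
      ((MvPolynomial.isHomogeneous_X _ _).mul ?_)
    · simpa using (MvPolynomial.isHomogeneous_X ℂ (vertex τ)).pow N
    · have := MvPolynomial.IsHomogeneous.prod Finset.univ
        (fun k => MvPolynomial.X (R := ℂ) (adjVertex τ k) ^ chartExp τ a k)
        (fun k => 1 * chartExp τ a k) fun k _ => (MvPolynomial.isHomogeneous_X ℂ _).pow _
      simpa using this
  have h := eval_eq_zero_of_mem_toricSet hom (fun t => ?_) hp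
  · simp only [map_sub, map_mul, map_pow, map_prod, MvPolynomial.eval_X] at h
    have hN := pow_ne_zero N hτ
    simp only [Pi.smul_apply, smul_eq_mul, monomials, div_pow, Finset.prod_div_distrib,
      Finset.prod_pow_eq_pow_sum]
    change _ * (_ / p.rep (vertex τ) ^ N) = _
    field_simp
    linear_combination -h
  · simp only [map_sub, map_mul, map_pow, map_prod, MvPolynomial.eval_X]
    rw [character_eq τ t _ (fun _ => rfl) a]
    have : ∀ k, character t (adjVertex τ k) = _ := fun k =>
      (character_eq τ t _ (fun _ => rfl) (adjVertex τ k)).trans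
        (by rw [monomials_of_eq_single (chartExp_adjVertex τ k)])
    simp only [this, mul_pow, Finset.prod_mul_distrib, Finset.prod_pow_eq_pow_sum, monomials]
    ring

lemma chart_mem_toricSet (τ : Equiv.Perm (Fin (n + 1))) (y : Fin n → ℂ) :
    chart τ y ∈ toricSet (latticePoints (permutohedron (n + 1))) := by
  rw [toricSet, PSpace.isTopologicalBasis.mem_closure_iff]
  rintro _ ⟨d, f, hf, rfl⟩ hy
  rw [chart, PSpace.mk_mem_basicOpen hf] at hy
  let g : MvPolynomial (Fin n) ℂ :=
    MvPolynomial.bind₁ (fun a => ∏ k, MvPolynomial.X k ^ chartExp τ a k) f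
  have hg : ∀ z, MvPolynomial.eval z g = MvPolynomial.eval (monomials (chartExp τ) z) f := by
    intro z
    have := MvPolynomial.eval₂Hom_bind₁ (RingHom.id ℂ) z
      (fun a => ∏ k, MvPolynomial.X k ^ chartExp τ a k) f
    simp only [MvPolynomial.coe_eval₂Hom] at this
    change MvPolynomial.eval₂ (RingHom.id ℂ) z g = MvPolynomial.eval₂ (RingHom.id ℂ) _ f
    rw [this]
    congr 1
    funext a
    simp [monomials]
  have hg0 : g ≠ 0 := fun h => hy (by rw [← hg, h, map_zero])
  -- A polynomial that does not vanish identically on the affine chart does not vanish identically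
  -- on the open torus.
  have hne : g * ∏ k, MvPolynomial.X k ≠ 0 :=
    mul_ne_zero hg0 (Finset.prod_ne_zero_iff.2 fun k _ => MvPolynomial.X_ne_zero k)
  obtain ⟨z, hz⟩ : ∃ z, MvPolynomial.eval z (g * ∏ k, MvPolynomial.X k) ≠ 0 := by
    by_contra! h
    exact hne (MvPolynomial.funext fun z => by rw [h z, map_zero])
  rw [map_mul, mul_ne_zero_iff, map_prod, Finset.prod_ne_zero_iff, hg] at hz
  have hz' : ∀ k, z k ≠ 0 := fun k => by simpa using hz.2 k (Finset.mem_univ k)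
  let w : Fin n → ℂˣ := fun k => Units.mk0 (z k) (hz' k)
  let t : Fin (n + 1) → ℂˣ := fun i => (Fin.partialProd w (τ i))⁻¹
  have ht : ∀ k : Fin n, z k = t (τ.symm k.castSucc) / t (τ.symm k.succ) := by
    intro k
    have : ((Fin.partialProd w k.castSucc : ℂˣ) : ℂ) ≠ 0 := Units.ne_zero _
    simp only [t, Equiv.apply_symm_apply, Fin.partialProd_succ, Units.val_inv_eq_inv_val,
      Units.val_mul, w, Units.val_mk0]
    field_simp
  have hch : character t = character t (vertex τ) • monomials (chartExp τ) z :=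
    funext fun a => character_eq τ t z ht a
  have hne0 : character t ≠ 0 := Function.ne_iff.2 ⟨vertex τ, character_ne_zero _ _⟩
  refine ⟨PSpace.mk (character t) hne0, ?_, t, hne0, rfl⟩
  rw [PSpace.mk_mem_basicOpen hf, hch, PSpace.eval_smul hf]
  exact mul_ne_zero (pow_ne_zero _ (character_ne_zero _ _)) hz.1

/-! ### The charts cover -/

/-- A positive multiple of a lattice point of the permutohedron is a combination of vertices with
coefficients in `ℕ`. The coefficients of a real convex combination of affinely independent rational
points are unchanged by a `ℚ`-linear retraction `ℝ → ℚ`, so they are rational. -/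
lemma exists_nat_combination (a : latticePoints (permutohedron (n + 1))) :
    ∃ (κ : Type) (_ : Fintype κ) (σ : κ → Equiv.Perm (Fin (n + 1))) (c : κ → ℕ), ∑ k, c k ≠ 0 ∧
      ∀ i, ((∑ k, c k : ℕ) : ℤ) * (a : Fin (n + 1) → ℤ) i =
        ∑ k, (c k : ℤ) * (vertex (σ k) : Fin (n + 1) → ℤ) i := by
  obtain ⟨κ, _, z, w, hz, hind, hw, hw1, hsum⟩ := eq_pos_convex_span_of_mem_convexHull a.2
  choose σ hσ using fun k => hz ⟨k, rfl⟩
  obtain ⟨φ, hφ⟩ := (Algebra.linearMap ℚ ℝ).exists_leftInverse_of_injective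
    (LinearMap.ker_eq_bot.2 (algebraMap ℚ ℝ).injective)
  have hφq : ∀ q : ℚ, φ q = q := fun q => by
    simpa using LinearMap.congr_fun hφ q
  have hφm : ∀ (x : ℝ) (q : ℚ), φ (x * q) = φ x * q := fun x q => by
    rw [mul_comm, ← Rat.smul_def, map_smul, smul_eq_mul, mul_comm]
  have hz' : ∀ k i, z k i = (((σ k i : ℕ) + 1 : ℚ) : ℝ) := fun k i => by
    rw [← hσ]; simp
  have hsum' : ∀ i, ∑ k, w k * z k i = (a : Fin (n + 1) → ℤ) i := fun i => by
    simpa using congrFun hsum i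
  have h1 : ∑ k, φ (w k) = 1 := by
    rw [← map_sum, hw1]; exact_mod_cast hφq 1
  have h2 : ∀ i, ∑ k, φ (w k) * ((σ k i : ℕ) + 1 : ℚ) = (a : Fin (n + 1) → ℤ) i := fun i => by
    have := congrArg φ (hsum' i)
    simp only [map_sum, hz', hφm] at this
    rw [this]; exact_mod_cast hφq ((a : Fin (n + 1) → ℤ) i)
  have hrat : ∀ k, w k = φ (w k) := by
    have h3 := affineIndependent_iff.1 hind Finset.univ (fun k => w k - φ (w k)) ?_ ?_
    · exact fun k => sub_eq_zero.1 (h3 k (Finset.mem_univ k))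
    · rw [Finset.sum_sub_distrib, hw1, sub_eq_zero]; exact_mod_cast h1.symm
    · funext i
      simp only [Finset.sum_apply, Pi.smul_apply, smul_eq_mul, sub_mul, Finset.sum_sub_distrib,
        hsum', Pi.zero_apply, sub_eq_zero]
      simp only [hz']
      exact_mod_cast (h2 i).symm
  have hpos : ∀ k, 0 < φ (w k) := fun k => by
    have := hw k
    rw [hrat k] at this
    exact_mod_cast this
  let M : ℕ := ∏ k, (φ (w k)).den
  have hM : M ≠ 0 := Finset.prod_ne_zero_iff.2 fun k _ => (φ (w k)).den_nz
  have hc : ∀ k, ∃ c : ℕ, (c : ℚ) = M * φ (w k) := fun k => by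
    obtain ⟨m, hm⟩ : (φ (w k)).den ∣ M := Finset.dvd_prod_of_mem _ (Finset.mem_univ k)
    refine ⟨m * (φ (w k)).num.toNat, ?_⟩
    have h4 : (((φ (w k)).num.toNat : ℕ) : ℚ) = (φ (w k)).num := by
      exact_mod_cast congrArg (fun z : ℤ => (z : ℚ)) (Int.toNat_of_nonneg (Rat.num_nonneg.2 (hpos k).le))
    have h5 := Rat.mul_den_eq_num (φ (w k))
    rw [hm]; push_cast; rw [h4, ← h5]; ring
  choose c hc using hc
  have hcs : ((∑ k, c k : ℕ) : ℚ) = M := by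
    push_cast; simp only [hc]; rw [← Finset.mul_sum, h1, mul_one]
  refine ⟨_, inferInstance, σ, c, fun h => hM ?_, fun i => ?_⟩
  · rw [h] at hcs; exact_mod_cast hcs.symm
  · have : (((∑ k, c k : ℕ) : ℤ) : ℚ) * ((a : Fin (n + 1) → ℤ) i : ℚ) =
        ∑ k, (c k : ℚ) * (((vertex (σ k) : Fin (n + 1) → ℤ) i : ℤ) : ℚ) := by
      rw [Int.cast_natCast, hcs, ← h2, Finset.mul_sum]
      refine Finset.sum_congr rfl fun k _ => ?_
      rw [hc, vertex_apply]; push_cast; ring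
    exact_mod_cast this

lemma zpow_sum {κ : Type*} {x : ℂ} (hx : x ≠ 0) (s : Finset κ) (c : κ → ℤ) :
    x ^ (∑ k ∈ s, c k) = ∏ k ∈ s, x ^ c k := by
  classical
  induction s using Finset.induction_on with
  | empty => simp
  | insert k s hk ih => rw [Finset.sum_insert hk, Finset.prod_insert hk, zpow_add₀ hx, ih]

/-- A relation `N a = ∑ k, c k • vertex (σ k)` gives the binomial equation
`X_a ^ N = ∏ k, X_{σ k} ^ c k`, so the coordinates at the vertices have no common zero. -/
lemma exists_vertex_ne_zero {p : PSpace (latticePoints (permutohedron (n + 1)))}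
    (hp : p ∈ toricSet (latticePoints (permutohedron (n + 1)))) :
    ∃ τ : Equiv.Perm (Fin (n + 1)), p.rep (vertex τ) ≠ 0 := by
  by_contra! hv
  refine p.rep_ne_zero (funext fun a => ?_)
  obtain ⟨κ, _, σ, c, hc, h⟩ := exists_nat_combination a
  have hom : (MvPolynomial.X a ^ (∑ k, c k) - ∏ k, MvPolynomial.X (vertex (σ k)) ^ c k :
      MvPolynomial (latticePoints (permutohedron (n + 1))) ℂ).IsHomogeneous (∑ k, c k) := by
    refine MvPolynomial.IsHomogeneous.sub ?_ ?_
    · simpa using (MvPolynomial.isHomogeneous_X ℂ a).pow (∑ k, c k)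
    · have := MvPolynomial.IsHomogeneous.prod Finset.univ
        (fun k => MvPolynomial.X (R := ℂ) (vertex (σ k)) ^ c k)
        (fun k => 1 * c k) fun k _ => (MvPolynomial.isHomogeneous_X ℂ _).pow _
      simpa using this
  have h0 := eval_eq_zero_of_mem_toricSet hom (fun t => ?_) hp
  · obtain ⟨k, _, hk⟩ := Finset.exists_ne_zero_of_sum_ne_zero hc
    simp only [map_sub, map_pow, map_prod, MvPolynomial.eval_X, hv] at h0
    rw [Finset.prod_eq_zero (Finset.mem_univ k) (zero_pow hk), sub_zero] at h0
    exact pow_eq_zero_iff hc |>.1 h0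
  · simp only [map_sub, map_pow, map_prod, MvPolynomial.eval_X, character, ← Finset.prod_pow,
      sub_eq_zero]
    rw [Finset.prod_comm]
    refine Finset.prod_congr rfl fun i _ => ?_
    simp only [← zpow_natCast, ← zpow_mul]
    rw [mul_comm, h, zpow_sum (t i).ne_zero]
    exact Finset.prod_congr rfl fun k _ => by rw [mul_comm]

/-! ### Chains of proper subsets -/

section Chains

variable {α : Type} [DecidableEq α]

/-- The nonempty proper subsets of `S`. -/
def properSubsets (S : Finset α) : Finset (Finset α) :=
  S.powerset.filter fun T => T ≠ ∅ ∧ T ≠ S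

lemma mem_properSubsets {S T : Finset α} : T ∈ properSubsets S ↔ T ⊆ S ∧ T ≠ ∅ ∧ T ≠ S := by
  simp [properSubsets]

open Classical in
/-- The chains of nonempty proper subsets of `S`. They encode the ordered set partitions of `S`, and
hence the faces of the permutohedron: such a partition corresponds to the chain of the unions of
its initial segments. -/
def properChains (S : Finset α) : Finset (Finset (Finset α)) :=
  (properSubsets S).powerset.filter fun C => IsChain (· ⊆ ·) (C : Set (Finset α))

lemma mem_properChains {S : Finset α} {C : Finset (Finset α)} :
    C ∈ properChains S ↔ C ⊆ properSubsets S ∧ IsChain (· ⊆ ·) (C : Set (Finset α)) := by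
  simp [properChains]

lemma card_le_of_mem_properChains {S : Finset α} {C : Finset (Finset α)} (hC : C ∈ properChains S) :
    C.card ≤ S.card - 1 := by
  rw [mem_properChains] at hC
  have h : C.card ≤ (Finset.Ioo 0 S.card).card := by
    refine Finset.card_le_card_of_injOn Finset.card (fun T hT => ?_) fun T hT T' hT' h => ?_
    · obtain ⟨h1, h2, h3⟩ := mem_properSubsets.1 (hC.1 hT)
      simp only [Finset.coe_Ioo, Set.mem_Ioo]
      exact ⟨Finset.card_pos.2 (Finset.nonempty_iff_ne_empty.2 h2),
        Finset.card_lt_card (h1.ssubset_of_ne h3)⟩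
    · rcases hC.2.total hT hT' with h' | h'
      · exact Finset.eq_of_subset_of_card_le h' h.ge
      · exact (Finset.eq_of_subset_of_card_le h' h.le).symm
  simpa using h

lemma sup_mem_of_isChain {C : Finset (Finset α)} (hC : IsChain (· ⊆ ·) (C : Set (Finset α))) :
    C.sup id ∈ insert ∅ C := by
  have h := Finset.sup_mem (insert ∅ (C : Set (Finset α))) (Set.mem_insert _ _) ?_ C id
    fun T hT => Set.mem_insert_of_mem _ hT
  · simpa using h
  · rintro T (rfl | hT) T' (rfl | hT')
    · simp
    · simpa using Or.inr hT'
    · simpa using Or.inr hT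
    · rcases hC.total hT hT' with h | h
      · rw [sup_eq_right.2 h]; exact Or.inr hT'
      · rw [sup_eq_left.2 h]; exact Or.inr hT

variable {R : Type*} [CommRing R]

/-- The sum over all ordered set partitions of `S`, where a partition into `r` blocks has the weight
`L (S.card - r)`. For `S = ∅` there is only the empty chain, whose weight is `L 0` because of the
truncated subtraction; this is the right value for the empty partition if `L 0 = 1`. -/
def chainSum (L : ℕ → R) (S : Finset α) : R :=
  ∑ C ∈ properChains S, L (S.card - 1 - C.card)

lemma properChains_empty : properChains (∅ : Finset α) = {∅} := by
  ext C
  rw [mem_properChains, Finset.mem_singleton]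
  have : properSubsets (∅ : Finset α) = ∅ := by
    ext T
    rw [mem_properSubsets]
    simp
  rw [this, Finset.subset_empty]
  exact ⟨fun h => h.1, fun h => ⟨h, by simp [h]⟩⟩

/-- The chains with largest member `T` (where `T = ∅` stands for the empty chain) correspond to the
chains of proper subsets of `T`. -/
lemma sum_properChains_filter {L : ℕ → R} (hL0 : L 0 = 1) (hL : ∀ a b, L (a + b) = L a * L b)
    {S T : Finset α} (hT : T ∈ S.ssubsets) :
    ∑ C ∈ (properChains S).filter (fun C => C.sup id = T), L (S.card - 1 - C.card) =
      chainSum L T * L (S.card - T.card - 1) := by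
  have hTS : T ⊂ S := Finset.mem_ssubsets.1 hT
  by_cases hT0 : T = ∅
  · subst hT0
    have h1 : (properChains S).filter (fun C => C.sup id = ∅) = {∅} := by
      ext C
      rw [Finset.mem_filter, Finset.mem_singleton]
      constructor
      · rintro ⟨hC, h⟩
        refine Finset.eq_empty_of_forall_notMem fun T hT => ?_
        have h' := Finset.le_sup (f := id) hT
        rw [h] at h'
        exact (mem_properSubsets.1 ((mem_properChains.1 hC).1 hT)).2.1 (Finset.subset_empty.1 h')
      · rintro rfl
        exact ⟨mem_properChains.2 ⟨Finset.empty_subset _, by simp⟩, rfl⟩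
    simp [h1, chainSum, properChains_empty, hL0]
  · have hmem : ∀ C ∈ properChains S, C.sup id = T → T ∈ C := by
      intro C hC h
      have := sup_mem_of_isChain (mem_properChains.1 hC).2
      rw [h, Finset.mem_insert] at this
      exact this.resolve_left hT0
    have herase : ∀ C ∈ properChains S, C.sup id = T → C.erase T ∈ properChains T := by
      intro C hC h
      rw [mem_properChains] at hC ⊢
      refine ⟨fun U hU => ?_, hC.2.mono (by simp)⟩
      rw [Finset.mem_erase] at hU
      have hU' := Finset.le_sup (f := id) hU.2
      rw [h] at hU'
      exact mem_properSubsets.2 ⟨hU', (mem_properSubsets.1 (hC.1 hU.2)).2.1, hU.1⟩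
    rw [chainSum, Finset.sum_mul]
    refine Finset.sum_bij' (fun C _ => C.erase T) (fun C _ => insert T C) ?_ ?_ ?_ ?_ ?_
    · intro C hC
      rw [Finset.mem_filter] at hC
      exact herase C hC.1 hC.2
    · intro C hC
      rw [mem_properChains] at hC
      have hCT : ∀ U ∈ C, U ⊆ T := fun U hU => (mem_properSubsets.1 (hC.1 hU)).1
      rw [Finset.mem_filter, mem_properChains]
      refine ⟨⟨fun U hU => ?_, ?_⟩, ?_⟩
      · rcases Finset.mem_insert.1 hU with rfl | hU
        · exact mem_properSubsets.2 ⟨hTS.subset, hT0, hTS.ne⟩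
        · refine mem_properSubsets.2 ⟨(hCT U hU).trans hTS.subset,
            (mem_properSubsets.1 (hC.1 hU)).2.1, ?_⟩
          rintro rfl
          exact hTS.not_subset (hCT _ hU)
      · rw [Finset.coe_insert]
        exact hC.2.insert fun U hU _ => Or.inr (hCT U hU)
      · rw [Finset.sup_insert, id, sup_eq_left]
        exact Finset.sup_le hCT
    · intro C hC
      rw [Finset.mem_filter] at hC
      exact Finset.insert_erase (hmem C hC.1 hC.2)
    · intro C hC
      refine Finset.erase_insert fun h => ?_
      exact (mem_properSubsets.1 ((mem_properChains.1 hC).1 h)).2.2 rfl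
    · intro C hC
      rw [Finset.mem_filter] at hC
      have h1 := Finset.card_erase_of_mem (hmem C hC.1 hC.2)
      have h2 : 0 < C.card := Finset.card_pos.2 ⟨T, hmem C hC.1 hC.2⟩
      have h3 := card_le_of_mem_properChains hC.1
      have h4 := Finset.card_lt_card hTS
      have h5 : 0 < T.card := Finset.card_pos.2 (Finset.nonempty_iff_ne_empty.2 hT0)
      have h6 := card_le_of_mem_properChains (herase C hC.1 hC.2)
      rw [← hL]
      congr 1
      omega

/-- The recursion that splits off the last block of an ordered set partition. -/
lemma chainSum_eq_sum_ssubsets {L : ℕ → R} (hL0 : L 0 = 1) (hL : ∀ a b, L (a + b) = L a * L b)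
    {S : Finset α} (hS : S.Nonempty) :
    chainSum L S = ∑ T ∈ S.ssubsets, chainSum L T * L (S.card - T.card - 1) := by
  rw [chainSum, ← Finset.sum_fiberwise_of_maps_to (g := fun C => C.sup id) (t := S.ssubsets)]
  · exact Finset.sum_congr rfl fun T hT => sum_properChains_filter hL0 hL hT
  · intro C hC
    rw [mem_properChains] at hC
    rw [Finset.mem_ssubsets]
    rcases Finset.mem_insert.1 (sup_mem_of_isChain hC.2) with h | h
    · rw [h]; exact Finset.empty_ssubset.2 hS
    · have := mem_properSubsets.1 (hC.1 h)
      exact this.1.ssubset_of_ne this.2.2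

lemma sum_ssubsets_apply_card (f : ℕ → R) (S : Finset α) :
    ∑ T ∈ S.ssubsets, f T.card = ∑ k ∈ Finset.range S.card, (S.card.choose k : R) * f k := by
  have h := Finset.sum_powerset_apply_card f (x := S)
  rw [Finset.sum_range_succ, ← Finset.sum_erase_add _ _ (Finset.mem_powerset_self S)] at h
  simpa [Finset.ssubsets, sub_eq_iff_eq_add] using h

/-- The sum `chainSum L S` depends on the cardinality of `S` only. -/
lemma chainSum_eq_chainSum_range {L : ℕ → R} (hL0 : L 0 = 1) (hL : ∀ a b, L (a + b) = L a * L b)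
    (S : Finset α) : chainSum L S = chainSum L (Finset.range S.card) := by
  suffices H : ∀ (N : ℕ) (β : Type) [DecidableEq β] (T : Finset β), T.card = N →
      chainSum L T = chainSum L (Finset.range N) from H _ α S rfl
  intro N
  induction N using Nat.strong_induction_on with
  | _ N ih =>
    have key : ∀ (β : Type) [DecidableEq β] (T : Finset β), T.card = N → T.Nonempty →
        chainSum L T = ∑ k ∈ Finset.range N, (N.choose k : R) *
          (chainSum L (Finset.range k) * L (N - k - 1)) := by
      rintro β _ T hT hne
      rw [chainSum_eq_sum_ssubsets hL0 hL hne, hT,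
        ← hT, ← sum_ssubsets_apply_card (fun k => chainSum L (Finset.range k) * L (T.card - k - 1))]
      refine Finset.sum_congr rfl fun U hU => ?_
      rw [ih U.card (hT ▸ Finset.card_lt_card (Finset.mem_ssubsets.1 hU)) β U rfl]
    intro β _ T hT
    rcases T.eq_empty_or_nonempty with rfl | hne
    · rw [Finset.card_empty] at hT
      subst hT
      simp [chainSum, properChains_empty]
    · rw [key β T hT hne, key ℕ (Finset.range N) (Finset.card_range N)]
      rw [← Finset.card_pos, Finset.card_range, ← hT]
      exact hne.card_pos

lemma chainSum_range {L : ℕ → R} (hL0 : L 0 = 1) (hL : ∀ a b, L (a + b) = L a * L b) {N : ℕ}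
    (hN : N ≠ 0) : chainSum L (Finset.range N) =
      ∑ k ∈ Finset.range N, (N.choose k : R) * (chainSum L (Finset.range k) * L (N - k - 1)) := by
  rw [chainSum_eq_sum_ssubsets hL0 hL (Finset.nonempty_range_iff.2 hN), Finset.card_range]
  have := sum_ssubsets_apply_card (fun k => chainSum L (Finset.range k) * L (N - k - 1))
    (Finset.range N)
  rw [Finset.card_range] at this
  rw [← this]
  exact Finset.sum_congr rfl fun T _ => by rw [← chainSum_eq_chainSum_range hL0 hL T]

end Chains

/-! ### The torus orbits of the permutohedral variety -/

/-- The toric divisor of a set `S` of indices, cut out by the coordinates of the lattice points off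
the facet of the permutohedron on which the sum of the coordinates in `S` is least. -/
def divisor (S : Finset (Fin (n + 1))) : Set (PSpace (latticePoints (permutohedron (n + 1)))) :=
  {p | ∀ a : latticePoints (permutohedron (n + 1)), defect (a : Fin (n + 1) → ℤ) S ≠ 0 →
    p.rep a = 0}

lemma isClosed_divisor (S : Finset (Fin (n + 1))) : IsClosed (divisor S) := by
  have h : divisor S = ⋂ (a : latticePoints (permutohedron (n + 1)))
      (_ : defect (a : Fin (n + 1) → ℤ) S ≠ 0), (PSpace.basicOpen (.X a))ᶜ := by
    ext p
    simp [divisor, PSpace.basicOpen]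
  rw [h]
  exact isClosed_iInter fun a => isClosed_iInter fun _ =>
    (PSpace.isOpen_basicOpen (MvPolynomial.isHomogeneous_X _ _)).isClosed_compl

lemma rep_chart_eq_zero_iff (τ : Equiv.Perm (Fin (n + 1))) (y : Fin n → ℂ)
    (a : latticePoints (permutohedron (n + 1))) :
    (chart τ y).rep a = 0 ↔ ∃ k, y k = 0 ∧ chartExp τ a k ≠ 0 := by
  rw [chart, PSpace.rep_mk_eq_zero_iff, monomials_eq_zero_iff]

lemma rep_chart_vertex_ne_zero (τ : Equiv.Perm (Fin (n + 1))) (y : Fin n → ℂ) :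
    (chart τ y).rep (vertex τ) ≠ 0 := by
  simp [rep_chart_eq_zero_iff, chartExp_vertex_self]

lemma flagSet_mem_properSubsets (τ : Equiv.Perm (Fin (n + 1))) (k : Fin n) :
    flagSet τ k ∈ properSubsets (Finset.univ : Finset (Fin (n + 1))) := by
  have h := card_flagSet τ k
  refine mem_properSubsets.2 ⟨Finset.subset_univ _, fun h' => ?_, fun h' => ?_⟩
  · rw [h', Finset.card_empty] at h
    omega
  · rw [h', Finset.card_fin] at h
    omega

lemma exists_eq_flagSet {τ : Equiv.Perm (Fin (n + 1))} {S : Finset (Fin (n + 1))}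
    (hS : S ∈ properSubsets (Finset.univ : Finset (Fin (n + 1))))
    (h : S = Finset.univ.filter fun i => (τ i : ℕ) < S.card) : ∃ k, flagSet τ k = S := by
  obtain ⟨h1, h2, h3⟩ := mem_properSubsets.1 hS
  have h4 := Finset.card_lt_card (h1.ssubset_of_ne h3)
  have h5 : 0 < S.card := Finset.card_pos.2 (Finset.nonempty_iff_ne_empty.2 h2)
  rw [Finset.card_fin] at h4
  refine ⟨⟨S.card - 1, by omega⟩, ?_⟩
  conv_rhs => rw [h]
  ext i
  simp only [flagSet, Finset.mem_filter, Finset.mem_univ, true_and, Fin.le_def, Fin.val_castSucc]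
  omega

/-- In an affine chart the toric divisors are the coordinate hyperplanes. -/
lemma chart_mem_divisor_iff (τ : Equiv.Perm (Fin (n + 1))) (y : Fin n → ℂ)
    {S : Finset (Fin (n + 1))} (hS : S ∈ properSubsets (Finset.univ : Finset (Fin (n + 1)))) :
    chart τ y ∈ divisor S ↔ ∃ k, y k = 0 ∧ flagSet τ k = S := by
  constructor
  · intro h
    have h0 : defect (vertex τ : Fin (n + 1) → ℤ) S = 0 :=
      by_contra fun h' => rep_chart_vertex_ne_zero τ y (h _ h')
    obtain ⟨k, rfl⟩ := exists_eq_flagSet hS ((defect_vertex_eq_zero_iff τ S).1 h0)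
    have h1 := h (adjVertex τ k) (by rw [← natCast_chartExp, chartExp_adjVertex]; simp)
    obtain ⟨l, hl, hl'⟩ := (rep_chart_eq_zero_iff _ _ _).1 h1
    rw [chartExp_adjVertex, Pi.single_apply] at hl'
    have : l = k := by by_contra h'; simp [h'] at hl'
    exact ⟨k, this ▸ hl, rfl⟩
  · rintro ⟨k, hk, rfl⟩ a ha
    rw [← natCast_chartExp] at ha
    exact (rep_chart_eq_zero_iff _ _ _).2 ⟨k, hk, by exact_mod_cast ha⟩

/-- Every chain of proper subsets consists of sets of the flag of some permutation: the indices are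
sorted by the number of sets of the chain that do not contain them. -/
lemma exists_perm_of_isChain {C : Finset (Finset (Fin (n + 1)))}
    (hC : C ∈ properChains (Finset.univ : Finset (Fin (n + 1)))) :
    ∃ τ : Equiv.Perm (Fin (n + 1)), ∀ S ∈ C, ∃ k, flagSet τ k = S := by
  rw [mem_properChains] at hC
  let h : Fin (n + 1) → ℕ := fun i => (C.filter fun S => i ∉ S).card
  refine ⟨(Tuple.sort h).symm, fun S hS => exists_eq_flagSet (hC.1 hS) ?_⟩
  have hlt : ∀ i ∈ S, ∀ j ∉ S, (Tuple.sort h).symm i < (Tuple.sort h).symm j := by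
    intro i hi j hj
    by_contra hle
    have h1 := Tuple.monotone_sort h (not_lt.1 hle)
    simp only [Function.comp_apply, Equiv.apply_symm_apply] at h1
    refine absurd h1 (not_le.2 (Finset.card_lt_card ?_))
    refine ⟨fun T hT => ?_, fun h' => ?_⟩
    · rw [Finset.mem_filter] at hT ⊢
      refine ⟨hT.1, fun hjT => ?_⟩
      rcases hC.2.total hS hT.1 with h' | h'
      · exact hT.2 (h' hi)
      · exact hj (h' hjT)
    · exact (Finset.mem_filter.1 (h' (Finset.mem_filter.2 ⟨hS, hj⟩))).2 hi
  -- A set of values with all smaller values is an initial segment.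
  rw [← defect_vertex_eq_zero_iff, defect_vertex, sub_eq_zero]
  congr 1
  set T := S.map ((Tuple.sort h).symm.toEmbedding.trans Fin.valEmbedding) with hT
  have hlow : ∀ a ∈ T, ∀ b < a, b ∈ T := by
    intro a ha b hb
    simp only [hT, Finset.mem_map, Function.Embedding.trans_apply] at ha ⊢
    obtain ⟨i, hi, rfl⟩ := ha
    simp only [Equiv.coe_toEmbedding, Fin.valEmbedding_apply] at hb ⊢
    refine ⟨Tuple.sort h ⟨b, hb.trans (Fin.isLt _)⟩, ?_, by simp⟩
    by_contra hj
    have := hlt i hi _ hj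
    rw [Equiv.symm_apply_apply, Fin.lt_def] at this
    exact lt_asymm hb this
  refine Finset.eq_of_subset_of_card_le (fun a ha => ?_) (by simp)
  rw [Finset.mem_range]
  have := Finset.card_le_card (s := Finset.range (a + 1)) (t := T) fun b hb => by
    rcases (Nat.lt_succ_iff.1 (Finset.mem_range.1 hb)).eq_or_lt with rfl | hb
    · exact ha
    · exact hlow a ha b hb
  simpa using this

/-- Divisors that meet are in the flag of one permutation, namely that of a chart around a common
point. -/
lemma isChain_of_mem_stratum {C : Finset (Finset (Fin (n + 1)))}
    (hC : C ⊆ properSubsets (Finset.univ : Finset (Fin (n + 1))))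
    {p : PSpace (latticePoints (permutohedron (n + 1)))}
    (hp : p ∈ stratum (toricSet (latticePoints (permutohedron (n + 1)))) divisor
      (properSubsets Finset.univ) C) : IsChain (· ⊆ ·) (C : Set (Finset (Fin (n + 1)))) := by
  obtain ⟨ρ, hρ⟩ := exists_vertex_ne_zero hp.1
  obtain ⟨y, rfl⟩ := exists_eq_chart hp.1 hρ
  intro S hS T hT _
  obtain ⟨k, -, rfl⟩ := (chart_mem_divisor_iff ρ y (hC hS)).1 ((hp.2 S (hC hS)).2 hS)
  obtain ⟨l, -, rfl⟩ := (chart_mem_divisor_iff ρ y (hC hT)).1 ((hp.2 T (hC hT)).2 hT)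
  rcases le_total k l with h | h
  · refine Or.inl fun i hi => ?_
    simp only [flagSet, Finset.mem_filter, Finset.mem_univ, true_and] at hi ⊢
    exact hi.trans (Fin.castSucc_le_castSucc_iff.2 h)
  · refine Or.inr fun i hi => ?_
    simp only [flagSet, Finset.mem_filter, Finset.mem_univ, true_and] at hi ⊢
    exact hi.trans (Fin.castSucc_le_castSucc_iff.2 h)

/-- A stratum lies in a single chart, at any vertex whose flag contains the given chain. -/
lemma stratum_eq_chart {C : Finset (Finset (Fin (n + 1)))} (τ : Equiv.Perm (Fin (n + 1)))
    (hτ : ∀ S ∈ C, ∃ k, flagSet τ k = S) :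
    stratum (toricSet (latticePoints (permutohedron (n + 1)))) divisor
      (properSubsets Finset.univ) C =
      {p | ∃ y : Fin n → ℂ, (∀ k, y k ≠ 0 ↔ k ∈ Finset.univ.filter fun k => flagSet τ k ∉ C) ∧
        p = chart τ y} := by
  ext p
  constructor
  · intro hp
    have hv : p.rep (vertex τ) ≠ 0 := by
      -- In another chart around `p`, every vanishing affine coordinate has exponent `0` at `vertex τ`.
      obtain ⟨ρ, hρ⟩ := exists_vertex_ne_zero hp.1
      obtain ⟨y, rfl⟩ := exists_eq_chart hp.1 hρ
      rw [Ne, rep_chart_eq_zero_iff]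
      rintro ⟨k, hk, hne⟩
      have hJ := flagSet_mem_properSubsets ρ k
      obtain ⟨l, hl⟩ := hτ _ ((hp.2 _ hJ).1 ((chart_mem_divisor_iff ρ y hJ).2 ⟨k, hk, rfl⟩))
      apply hne
      rw [← Int.natCast_inj, natCast_chartExp, ← hl, ← natCast_chartExp, chartExp_vertex_self]
      rfl
    obtain ⟨y, rfl⟩ := exists_eq_chart hp.1 hv
    refine ⟨y, fun k => ?_, rfl⟩
    have hJ := flagSet_mem_properSubsets τ k
    rw [Finset.mem_filter, ← hp.2 _ hJ, chart_mem_divisor_iff τ y hJ]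
    simp [(flagSet_injective τ).eq_iff]
  · rintro ⟨y, hy, rfl⟩
    refine ⟨chart_mem_toricSet τ y, fun S hS => ?_⟩
    rw [chart_mem_divisor_iff τ y hS]
    have hy' : ∀ k, y k = 0 ↔ flagSet τ k ∈ C := fun k => by
      have := not_iff_not.2 (hy k)
      simpa using this
    constructor
    · rintro ⟨k, hk, rfl⟩
      exact (hy' k).1 hk
    · intro h
      obtain ⟨k, rfl⟩ := hτ S h
      exact ⟨k, (hy' k).2 h, rfl⟩

lemma clsSet_stratum {C : Finset (Finset (Fin (n + 1)))}
    (hC : C ∈ properChains (Finset.univ : Finset (Fin (n + 1)))) :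
    haveI := (finite_latticePoints_permutohedron (n + 1)).to_subtype
    clsSet (stratum (toricSet (latticePoints (permutohedron (n + 1)))) divisor
      (properSubsets Finset.univ) C) = cls (torus (n - C.card)) := by
  have := (finite_latticePoints_permutohedron (n + 1)).to_subtype
  obtain ⟨τ, hτ⟩ := exists_perm_of_isChain hC
  have h := clsSet_eq_cls_torus (chartExp τ) (vertex τ) (chartExp_vertex_self τ) (adjVertex τ)
    (chartExp_adjVertex τ) _ (isLocallyClosed_stratum isClosed_closure.isLocallyClosed
      isClosed_divisor _ _) (stratum_eq_chart τ hτ)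
  rw [toricSet, h]
  congr 2
  have h1 := Finset.card_filter_add_card_filter_not (s := (Finset.univ : Finset (Fin n)))
    (fun k => flagSet τ k ∈ C)
  have h2 : (Finset.univ.filter fun k => flagSet τ k ∈ C).card = C.card := by
    rw [← Finset.card_image_of_injective _ (flagSet_injective τ)]
    congr 1
    ext S
    simp only [Finset.mem_image, Finset.mem_filter, Finset.mem_univ, true_and]
    constructor
    · rintro ⟨k, hk, rfl⟩
      exact hk
    · intro hS
      obtain ⟨k, rfl⟩ := hτ S hS
      exact ⟨k, hS, rfl⟩
  rw [h2, Finset.card_fin] at h1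
  omega

/-- The class of the permutohedral variety is the sum of the classes of its torus orbits, which
correspond to the ordered set partitions. -/
lemma cls_permutohedralVariety (n : ℕ) :
    cls (permutohedralVariety n) =
      chainSum (fun k => cls (torus k)) (Finset.univ : Finset (Fin (n + 1))) := by
  classical
  have := (finite_latticePoints_permutohedron (n + 1)).to_subtype
  have hX : IsLocallyClosed (toricSet (latticePoints (permutohedron (n + 1)))) :=
    isClosed_closure.isLocallyClosed
  calc cls (permutohedralVariety n)
      = clsSet (toricSet (latticePoints (permutohedron (n + 1)))) :=
        (clsSet_of_isLocallyClosed hX).symm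
    _ = _ := by
      rw [clsSet_eq_sum_stratum hX isClosed_divisor (properSubsets Finset.univ), chainSum,
        properChains]
      symm
      refine (Finset.sum_congr rfl fun C hC => ?_).trans
        (Finset.sum_subset (Finset.filter_subset _ _) fun C hC hC' => ?_)
      · rw [clsSet_stratum hC, Finset.card_fin, Nat.add_sub_cancel]
      · rw [Finset.mem_powerset] at hC
        have : stratum (toricSet (latticePoints (permutohedron (n + 1)))) divisor
            (properSubsets Finset.univ) C = ∅ :=
          Set.eq_empty_of_forall_notMem fun p hp =>
            hC' (mem_properChains.2 ⟨hC, isChain_of_mem_stratum hC hp⟩)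
        rw [this, clsSet_empty]

/-! ### The generating series -/

lemma permutohedralCoeff_eq (N : ℕ) :
    permutohedralCoeff N = chainSum (fun k => cls (torus k)) (Finset.range N) := by
  cases N with
  | zero => simp [permutohedralCoeff, chainSum, properChains_empty, cls_torus_zero]
  | succ n =>
    rw [permutohedralCoeff, cls_permutohedralVariety,
      chainSum_eq_chainSum_range cls_torus_zero cls_torus_add, Finset.card_fin]

lemma sum_permutohedralCoeff_mul_torusCoeff (n : ℕ) :
    ∑ kl ∈ Finset.HasAntidiagonal.antidiagonal n,
      (n.choose kl.1 : K0) * permutohedralCoeff kl.1 * torusCoeff kl.2 = if n = 0 then 1 else 0 := by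
  rw [Finset.Nat.sum_antidiagonal_eq_sum_range_succ
    (fun k l => (n.choose k : K0) * permutohedralCoeff k * torusCoeff l), Finset.sum_range_succ]
  split_ifs with hn
  · subst hn
    simp [permutohedralCoeff, torusCoeff]
  · have h : ∀ k ∈ Finset.range n, (n.choose k : K0) * permutohedralCoeff k * torusCoeff (n - k) =
        -((n.choose k : K0) * (chainSum (fun k => cls (torus k)) (Finset.range k) *
          cls (torus (n - k - 1)))) := by
      intro k hk
      rw [Finset.mem_range] at hk
      obtain ⟨m, hm⟩ : ∃ m, n - k = m + 1 := ⟨n - k - 1, by omega⟩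
      rw [hm, torusCoeff, permutohedralCoeff_eq, Nat.add_sub_cancel]
      ring
    rw [Finset.sum_congr rfl h, Finset.sum_neg_distrib,
      ← chainSum_range cls_torus_zero cls_torus_add hn, ← permutohedralCoeff_eq]
    simp [torusCoeff]

lemma expSeries_mul_eq_one {R : Type*} [CommRing R] {a b : ℕ → R}
    (h : ∀ n : ℕ, ∑ kl ∈ Finset.HasAntidiagonal.antidiagonal n,
      (n.choose kl.1 : R) * a kl.1 * b kl.2 = if n = 0 then 1 else 0) :
    expSeries a * expSeries b = 1 := by
  ext n
  have key : ∀ kl ∈ Finset.HasAntidiagonal.antidiagonal n,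
      ((1 / (kl.1.factorial : ℚ)) ⊗ₜ[ℤ] a kl.1) * ((1 / (kl.2.factorial : ℚ)) ⊗ₜ[ℤ] b kl.2) =
        (1 / (n.factorial : ℚ)) ⊗ₜ[ℤ] ((n.choose kl.1 : R) * a kl.1 * b kl.2) := by
    rintro ⟨k, l⟩ hkl
    rw [Finset.HasAntidiagonal.mem_antidiagonal] at hkl
    simp only at hkl ⊢
    subst hkl
    have h1 : (1 / (k.factorial : ℚ)) * (1 / (l.factorial : ℚ)) =
        ((k + l).choose k : ℤ) • (1 / ((k + l).factorial : ℚ)) := by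
      have h2 := Nat.choose_mul_factorial_mul_factorial (Nat.le_add_right k l)
      rw [Nat.add_sub_cancel_left] at h2
      have h3 : (((k + l).choose k * k.factorial * l.factorial : ℕ) : ℚ) = (k + l).factorial := by
        rw [h2]
      push_cast at h3
      rw [zsmul_eq_mul, ← h3]
      have := Nat.cast_ne_zero (R := ℚ).2 k.factorial_ne_zero
      have := Nat.cast_ne_zero (R := ℚ).2 l.factorial_ne_zero
      have := Nat.cast_ne_zero (R := ℚ).2 (Nat.choose_pos (Nat.le_add_right k l)).ne'
      push_cast
      field_simp
    rw [Algebra.TensorProduct.tmul_mul_tmul, h1, TensorProduct.smul_tmul, zsmul_eq_mul, mul_assoc]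
    push_cast
    rfl
  simp only [expSeries, PowerSeries.coeff_mul, PowerSeries.coeff_mk, PowerSeries.coeff_one]
  rw [Finset.sum_congr rfl key, ← TensorProduct.tmul_sum, h]
  split_ifs with hn
  · subst hn
    simp [Algebra.TensorProduct.one_def]
  · simp

end Motivic

end

/-- The exponential generating series of the classes of permutohedral varieties and of algebraic
tori are multiplicatively inverse to each other: as exponential series with coefficients in the
Grothendieck ring itself (comparison of the coefficients of `x^n / n!` in the product), and as
power series over its rationalization. -/
theorem theorem5p1 :
    (∀ n : ℕ, ∑ kl ∈ Finset.HasAntidiagonal.antidiagonal n,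
      (n.choose kl.1 : Motivic.K0) * Motivic.permutohedralCoeff kl.1 * Motivic.torusCoeff kl.2 =
        if n = 0 then 1 else 0) ∧
    Motivic.expSeries Motivic.permutohedralCoeff * Motivic.expSeries Motivic.torusCoeff = 1 :=
  ⟨Motivic.sum_permutohedralCoeff_mul_torusCoeff,
    Motivic.expSeries_mul_eq_one Motivic.sum_permutohedralCoeff_mul_torusCoeff⟩
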